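/- Let $n\ge 0$ be an integer and let $\mathbf{Gr}(n,\mathbb C^{2n})$ be the complex manifold of $n$-dimensional complex subspaces of $\mathbb C^{2n}$, on which $g\in GL(2n,\mathbb C)$ acts by $\sigma_g(z)=gz$. Consider the holomorphic vector bundles over $\mathbf{Gr}(n,\mathbb C^{2n})$ with total spaces $$\mathcal N=\{(\mathcal Z,z)\in \mathbf{gl}(2n,\mathbb C)\times\mathbf{Gr}(n,\mathbb C^{2n}) : \operatorname{Im}\mathcal Z\subset z\subset\operatorname{Ker}\mathcal Z\},$$ $$\mathcal E=\{(w,z)\in\mathbb C^{2n}\times\mathbf{Gr}(n,\mathbb C^{2n}) : w\in z\},\qquad \mathcal E^{\bot}=\{(\varphi,z)\in(\mathbb C^{2n})^*\times\mathbf{Gr}(n,\mathbb C^{2n}) : \varphi|_z=0\},$$ their tensor product $\mathcal E\otimes\mathcal E^\bot$, and the holomorphic cotangent bundle $T^*\mathbf{Gr}(n,\mathbb C^{2n})$. For $g\in GL(2n,\mathbb C)$ put $\Sigma_g(\mathcal Z,z)=(g\mathcal Zg^{-1},gz)$, $T_g(w,z)=(gw,gz)$, $T^*_g(\varphi,z)=(\varphi\circ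 g^{-1},gz)$, and let $T^*\sigma_g$ be the cotangent lift $(\alpha,z)\mapsto(\alpha\circ(d\sigma_g(z))^{-1},gz)$. (i) There are isomorphisms of holomorphic vector bundles over $\mathbf{Gr}(n,\mathbb C^{2n})$ $$\mathcal N\;\cong\;\mathcal E\otimes\mathcal E^\bot\;\cong\;T^*\mathbf{Gr}(n,\mathbb C^{2n}),$$ which are canonical in the following sense. The first one corresponds to $w\otimes\varphi\mapsto(v\mapsto\varphi(v)w)$. The composition of the two sends $\mathcal Z\in\mathcal N_z$ to the covector $X\mapsto\operatorname{Tr}(\mathcal Z\cdot d\phi_p(z)X)$ for every idempotent $p$ with $\operatorname{Im}p=z$, where $\phi_p(z')=q_{z'}-p$ and $q_{z'}$ is the projection of $\mathbb C^{2n}$ onto $z'$ along $\operatorname{Ker}p$, for $z'$ with $z'\oplus\operatorname{Ker}p=\mathbb C^{2n}$. (ii) $\Sigma_g$, $T_g\otimes T_g^*$ and $T^*\sigma_g$ define actions of $GL(2n,\mathbb C)$ on $\mathcal N$, $\mathcal E\otimes\mathcal E^\bot$ and $T^*\mathbf{Gr}(n,\mathbb C^{2n})$, respectively, by holomorphic vector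 bundle automorphisms covering $\sigma_g$, and the isomorphisms of (i) are $GL(2n,\mathbb C)$-equivariant. (iii) $\mathcal N$ is the disjoint union of the sets $$\mathcal N^k=\{(\mathcal Z,z)\in\mathcal N : \dim_{\mathbb C}\operatorname{Im}\mathcal Z=k\},\qquad k=0,1,\dots,n,$$ and each $\mathcal N^k$ is a single $GL(2n,\mathbb C)$-orbit. Consequently $\mathcal E\otimes\mathcal E^\bot$ and $T^*\mathbf{Gr}(n,\mathbb C^{2n})$ are the disjoint unions of the images of $\mathcal N^0,\dots,\mathcal N^n$ under the isomorphisms of (i), and each image is a single $GL(2n,\mathbb C)$-orbit. -/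

import Mathlib

open Set Bundle Topology
open scoped Manifold ContDiff TensorProduct Topology

noncomputable section

namespace GrBundles

/-- The space `ℂ²ⁿ`. -/
abbrev V (n : ℕ) : Type := Fin (2 * n) → ℂ

/-- The space `ℂⁿ`. -/
abbrev K (n : ℕ) : Type := Fin n → ℂ

/-- The space of `n × n` complex matrices, as the endomorphisms of `ℂⁿ`. -/
abbrev M (n : ℕ) : Type := K n →L[ℂ] K n

/-- The Lie algebra `gl(2n, ℂ)`. -/
abbrev gl (n : ℕ) : Type := V n →L[ℂ] V n

/-- The group `GL(2n, ℂ)` of invertible linear maps of `ℂ²ⁿ`. -/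
abbrev GL2 (n : ℕ) : Type := V n ≃L[ℂ] V n

/-- The Grassmannian of `n`-dimensional complex subspaces of `ℂ²ⁿ`. -/
@[ext]
structure Gr (n : ℕ) : Type where
  space : Submodule ℂ (V n)
  finrank_eq : Module.finrank ℂ space = n

variable {n : ℕ}

/-- The natural action `σ_g(z) = g z` of `GL(2n, ℂ)` on the Grassmannian. -/
instance : MulAction (GL2 n) (Gr n) where
  smul g z := ⟨z.space.map (g.toLinearEquiv : V n →ₗ[ℂ] V n), by
    rw [LinearEquiv.finrank_map_eq]; exact z.finrank_eq⟩
  one_smul z := by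
    ext x; exact ⟨fun ⟨y, hy, h⟩ => by rw [← h]; exact hy, fun h => ⟨x, h, rfl⟩⟩
  mul_smul g h z := by
    ext x
    constructor
    · rintro ⟨y, hy, rfl⟩; exact ⟨h y, ⟨y, hy, rfl⟩, rfl⟩
    · rintro ⟨_, ⟨y, hy, rfl⟩, rfl⟩; exact ⟨y, hy, rfl⟩

theorem mem_smul_of_mem (g : GL2 n) {z : Gr n} {w : V n} (h : w ∈ z.space) :
    g w ∈ (g • z).space := ⟨w, h, rfl⟩

theorem inv_mem_of_mem_smul (g : GL2 n) {z : Gr n} {w : V n} (h : w ∈ (g • z).space) :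
    g.symm w ∈ z.space := by
  obtain ⟨y, hy, rfl⟩ := h
  simpa using hy

/-! ### The complex manifold structure of the Grassmannian -/

/-- A splitting of `ℂ²ⁿ` into two copies of `ℂⁿ`; equivalently an idempotent `p` of rank `n`
with a basis of `Im p` and a basis of `Im (1 - p)`. -/
abbrev Split (n : ℕ) : Type := V n ≃L[ℂ] K n × K n

/-- The map `k ↦ e⁻¹(k, A k)`. -/
def graphMap (e : Split n) (A : M n) : K n →L[ℂ] V n :=
  (e.symm : K n × K n →L[ℂ] V n) ∘L
    (ContinuousLinearMap.inl ℂ (K n) (K n) + ContinuousLinearMap.inr ℂ (K n) (K n) ∘L A)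

theorem graphMap_apply (e : Split n) (A : M n) (k : K n) :
    graphMap e A k = e.symm (k, A k) := by
  simp [graphMap, ← map_add]

theorem graphMap_injective (e : Split n) (A : M n) : Function.Injective (graphMap e A) := by
  intro k l h
  rw [graphMap_apply, graphMap_apply] at h
  exact (Prod.ext_iff.1 (e.symm.injective h)).1

/-- The subspace of `ℂ²ⁿ` which the splitting `e` turns into the graph of `A`. -/
def graph (e : Split n) (A : M n) : Gr n where
  space := LinearMap.range (graphMap e A : K n →ₗ[ℂ] V n)
  finrank_eq := by
    rw [LinearMap.finrank_range_of_inj (graphMap_injective e A)]; simp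

theorem mem_graph {e : Split n} {A : M n} {w : V n} :
    w ∈ (graph e A).space ↔ (e w).2 = A (e w).1 := by
  constructor
  · rintro ⟨k, rfl⟩
    simp [graphMap_apply]
  · intro h
    refine ⟨(e w).1, ?_⟩
    simp [graphMap_apply, ← h]

theorem graph_injective (e : Split n) : Function.Injective (graph e) := by
  intro A B h
  ext1 k
  have : graphMap e A k ∈ (graph e B).space := by rw [← h]; exact ⟨k, rfl⟩
  rw [mem_graph] at this
  simpa [graphMap_apply] using this

/-- The standard affine chart of the Grassmannian given by a splitting `e`: it is defined on the
subspaces which are the graph (with respect to `e`) of a linear map, and sends such a subspace to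
this linear map. -/
def grChart (e : Split n) : PartialEquiv (Gr n) (M n) where
  toFun := Function.invFun (graph e)
  invFun := graph e
  source := Set.range (graph e)
  target := Set.univ
  map_source' _ _ := Set.mem_univ _
  map_target' A _ := ⟨A, rfl⟩
  left_inv' _ h := Function.invFun_eq h
  right_inv' A _ := Function.leftInverse_invFun (graph_injective e) A

theorem mem_iff_of_mem_source {e : Split n} {z : Gr n} (h : z ∈ (grChart e).source) {w : V n} :
    w ∈ z.space ↔ (e w).2 = grChart e z (e w).1 := by
  conv_lhs => rw [← (grChart e).left_inv h]
  exact mem_graph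

/-- The block `a + c A` of the transition between two charts. -/
def blockA (e e' : Split n) (A : M n) : M n :=
  ContinuousLinearMap.fst ℂ (K n) (K n) ∘L (e' : V n →L[ℂ] K n × K n) ∘L graphMap e A

/-- The block `b + d A` of the transition between two charts. -/
def blockB (e e' : Split n) (A : M n) : M n :=
  ContinuousLinearMap.snd ℂ (K n) (K n) ∘L (e' : V n →L[ℂ] K n × K n) ∘L graphMap e A

theorem contDiff_graphMap (e : Split n) : ContDiff ℂ ω (graphMap e) := by
  unfold graphMap
  fun_prop

theorem contDiff_blockA (e e' : Split n) : ContDiff ℂ ω (blockA e e') := by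
  unfold blockA
  have := contDiff_graphMap e
  fun_prop

theorem contDiff_blockB (e e' : Split n) : ContDiff ℂ ω (blockB e e') := by
  unfold blockB
  have := contDiff_graphMap e
  fun_prop

theorem graph_eq_of_isUnit {e e' : Split n} {A : M n} (h : IsUnit (blockA e e' A)) :
    graph e A = graph e' (blockB e e' A * Ring.inverse (blockA e e' A)) := by
  ext w
  rw [mem_graph (e := e')]
  have h1 : ∀ k, Ring.inverse (blockA e e' A) (blockA e e' A k) = k := fun k => by
    rw [← mul_apply_eq_comp, Ring.inverse_mul_cancel _ h]; rfl
  have h2 : ∀ k, blockA e e' A (Ring.inverse (blockA e e' A) k) = k := fun k => by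
    rw [← mul_apply_eq_comp, Ring.mul_inverse_cancel _ h]; rfl
  constructor
  · rintro ⟨k, rfl⟩
    have h3 := h1 k
    change Ring.inverse (blockA e e' A) (e' (graphMap e A k)).1 = k at h3
    change (e' (graphMap e A k)).2 = blockB e e' A (Ring.inverse (blockA e e' A)
      (e' (graphMap e A k)).1)
    rw [h3]
    rfl
  · intro hw
    refine ⟨Ring.inverse (blockA e e' A) (e' w).1, e'.injective (Prod.ext ?_ ?_)⟩
    · exact h2 _
    · exact hw.symm

theorem isUnit_of_graph_eq {e e' : Split n} {A B : M n} (h : graph e A = graph e' B) :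
    IsUnit (blockA e e' A) := by
  have hinj : Function.Injective (blockA e e' A) := by
    rw [injective_iff_map_eq_zero]
    intro k hk
    have hmem : graphMap e A k ∈ (graph e' B).space := by rw [← h]; exact ⟨k, rfl⟩
    rw [mem_graph] at hmem
    have hk' : (e' (graphMap e A k)).1 = 0 := hk
    rw [hk', map_zero] at hmem
    have : e' (graphMap e A k) = 0 := Prod.ext hk' hmem
    have h0 : graphMap e A k = 0 := by simpa using this
    exact graphMap_injective e A (by rw [h0, map_zero])
  let f : K n ≃ₗ[ℂ] K n := LinearEquiv.ofInjectiveEndo (blockA e e' A : K n →ₗ[ℂ] K n) hinj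
  refine ⟨ContinuousLinearEquiv.toUnit f.toContinuousLinearEquiv, ?_⟩
  ext1 k
  rfl

theorem trans_source (e e' : Split n) :
    ((grChart e).symm.trans (grChart e')).source = {A | IsUnit (blockA e e' A)} := by
  ext A
  simp only [PartialEquiv.trans_source, PartialEquiv.symm_source, mem_inter_iff, mem_preimage,
    mem_ofPred_eq]
  constructor
  · rintro ⟨-, B, hB⟩
    exact isUnit_of_graph_eq hB.symm
  · intro h
    exact ⟨mem_univ _, _, (graph_eq_of_isUnit h).symm⟩

theorem trans_eqOn (e e' : Split n) :
    EqOn ((grChart e).symm.trans (grChart e'))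
      (fun A => blockB e e' A * Ring.inverse (blockA e e' A))
      ((grChart e).symm.trans (grChart e')).source := by
  intro A hA
  rw [trans_source] at hA
  change Function.invFun (graph e') (graph e A) = _
  rw [graph_eq_of_isUnit hA]
  exact Function.leftInverse_invFun (graph_injective e') _

theorem contDiffOn_trans (e e' : Split n) :
    ContDiffOn ℂ ω ((grChart e).symm.trans (grChart e'))
      ((grChart e).symm.trans (grChart e')).source := by
  refine ContDiffOn.congr ?_ (trans_eqOn e e')
  rw [trans_source]
  intro A hA
  obtain ⟨u, hu⟩ : IsUnit (blockA e e' A) := hA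
  have h1 : ContDiffAt ℂ ω Ring.inverse (blockA e e' A) := hu ▸ contDiffAt_ringInverse ℂ u
  have h2 : ContDiffAt ℂ ω (fun A => Ring.inverse (blockA e e' A)) A :=
    h1.comp A (contDiff_blockA e e').contDiffAt
  exact ((contDiff_blockB e e').contDiffAt.clm_comp h2).contDiffWithinAt

theorem isOpen_trans_source (e e' : Split n) :
    IsOpen ((grChart e).symm.trans (grChart e')).source := by
  rw [trans_source]
  exact Units.isOpen.preimage (contDiff_blockA e e').continuous

/-- Every point of the Grassmannian is the centre of a chart. -/
theorem exists_split (z : Gr n) : ∃ e : Split n, graph e 0 = z := by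
  obtain ⟨c, hc⟩ := z.space.exists_isCompl
  have hdim : Module.finrank ℂ c = n := by
    have h1 := Submodule.finrank_add_eq_of_isCompl hc
    have h2 := z.finrank_eq
    simp only [Module.finrank_fintype_fun_eq_card, Fintype.card_fin] at h1
    omega
  let f : z.space ≃ₗ[ℂ] K n := LinearEquiv.ofFinrankEq _ _ (by rw [z.finrank_eq]; simp)
  let g : c ≃ₗ[ℂ] K n := LinearEquiv.ofFinrankEq _ _ (by rw [hdim]; simp)
  let e₀ : (K n × K n) ≃ₗ[ℂ] V n :=
    (LinearEquiv.prodCongr f.symm g.symm).trans (Submodule.prodEquivOfIsCompl _ _ hc)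
  let e : Split n := e₀.symm.toContinuousLinearEquiv
  refine ⟨e, ?_⟩
  ext w
  constructor
  · rintro ⟨k, rfl⟩
    have : graphMap e 0 k = (f.symm k : V n) := by
      rw [graphMap_apply]
      change (Submodule.prodEquivOfIsCompl _ _ hc) (f.symm k, g.symm 0) = _
      simp
    change graphMap e 0 k ∈ _
    rw [this]
    exact (f.symm k).2
  · intro hw
    refine ⟨f ⟨w, hw⟩, ?_⟩
    change graphMap e 0 (f ⟨w, hw⟩) = w
    rw [graphMap_apply]
    change (Submodule.prodEquivOfIsCompl _ _ hc) (f.symm (f ⟨w, hw⟩), g.symm 0) = _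
    simp

/-- A splitting whose chart is centred at `z`. -/
def splitAt (z : Gr n) : Split n := (exists_split z).choose

theorem mem_splitAt (z : Gr n) : z ∈ (grChart (splitAt z)).source :=
  ⟨0, (exists_split z).choose_spec⟩

/-- The atlas of the Grassmannian. -/
def grCore (n : ℕ) : ChartedSpaceCore (M n) (Gr n) where
  atlas := Set.range grChart
  chartAt z := grChart (splitAt z)
  mem_chart_source := mem_splitAt
  chart_mem_atlas z := ⟨_, rfl⟩
  open_source := by
    rintro _ _ ⟨e, rfl⟩ ⟨e', rfl⟩; exact isOpen_trans_source e e'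
  continuousOn_toFun := by
    rintro _ _ ⟨e, rfl⟩ ⟨e', rfl⟩; exact (contDiffOn_trans e e').continuousOn

instance : TopologicalSpace (Gr n) := (grCore n).toTopologicalSpace

instance : ChartedSpace (M n) (Gr n) := (grCore n).toChartedSpace

theorem mem_atlas_iff (f : OpenPartialHomeomorph (Gr n) (M n)) :
    f ∈ atlas (M n) (Gr n) ↔ ∃ e, f = (grCore n).openPartialHomeomorph (grChart e) ⟨e, rfl⟩ := by
  change f ∈ ⋃ (e : PartialEquiv (Gr n) (M n)) (he : e ∈ (grCore n).atlas),
    {(grCore n).openPartialHomeomorph e he} ↔ _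
  simp only [mem_iUnion, mem_singleton_iff]
  constructor
  · rintro ⟨_, ⟨e, rfl⟩, h⟩; exact ⟨e, h⟩
  · rintro ⟨e, h⟩; exact ⟨_, ⟨e, rfl⟩, h⟩

/-- The Grassmannian is a complex analytic manifold, modelled on the `n × n` matrices. -/
instance : IsManifold 𝓘(ℂ, M n) ω (Gr n) := by
  refine isManifold_of_contDiffOn _ _ _ ?_
  intro f f' hf hf'
  obtain ⟨e, rfl⟩ := (mem_atlas_iff f).1 hf
  obtain ⟨e', rfl⟩ := (mem_atlas_iff f').1 hf'
  exact (contDiffOn_trans e e').mono fun A hA => hA.1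

theorem isOpen_source (e : Split n) : IsOpen (grChart e).source :=
  (grCore n).open_source' ⟨e, rfl⟩

theorem contMDiffOn_grChart (e : Split n) :
    ContMDiffOn 𝓘(ℂ, M n) 𝓘(ℂ, M n) ω (grChart e) (grChart e).source :=
  contMDiffOn_of_mem_maximalAtlas (e := (grCore n).openPartialHomeomorph (grChart e) ⟨e, rfl⟩)
    (IsManifold.subset_maximalAtlas ((mem_atlas_iff _).2 ⟨e, rfl⟩))

/-! ### Vector bundles over the Grassmannian given by local frames -/

/-- Holomorphic local trivializations, one over the domain of each chart, of a family of vector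
spaces over the Grassmannian. The transition maps are analytic functions of the chart
coordinate. -/
structure Frames (F : Type) [NormedAddCommGroup F] [NormedSpace ℂ F] (E : Gr n → Type)
    [∀ z, AddCommGroup (E z)] [∀ z, Module ℂ (E z)] [∀ z, TopologicalSpace (E z)] where
  triv : ∀ (e : Split n) (z : Gr n), z ∈ (grChart e).source → (E z ≃ₗ[ℂ] F)
  isInducing : ∀ (e : Split n) (z : Gr n) (h : z ∈ (grChart e).source), IsInducing (triv e z h)
  change : Split n → Split n → M n → F →L[ℂ] F
  contDiff_change : ∀ e e', ContDiff ℂ ω (change e e')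
  change_apply : ∀ (e e' : Split n) (z : Gr n) (h : z ∈ (grChart e).source)
    (h' : z ∈ (grChart e').source) (v : F),
    change e e' (grChart e z) v = triv e' z h' ((triv e z h).symm v)

namespace Frames

variable {F : Type} [NormedAddCommGroup F] [NormedSpace ℂ F] {E : Gr n → Type}
    [∀ z, AddCommGroup (E z)] [∀ z, Module ℂ (E z)] [∀ z, TopologicalSpace (E z)]

open Classical in
/-- The trivialization over the domain of the chart of `e`. -/
def pretriv (a : Frames F E) (e : Split n) : Pretrivialization F (π F E) where
  toFun x := (x.1, if h : x.1 ∈ (grChart e).source then a.triv e x.1 h x.2 else 0)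
  invFun y := ⟨y.1, if h : y.1 ∈ (grChart e).source then (a.triv e y.1 h).symm y.2 else 0⟩
  source := π F E ⁻¹' (grChart e).source
  target := (grChart e).source ×ˢ univ
  map_source' x hx := ⟨hx, mem_univ _⟩
  map_target' y hy := hy.1
  left_inv' := by
    rintro ⟨z, v⟩ (hz : z ∈ (grChart e).source)
    simp [hz]
  right_inv' := by
    rintro ⟨z, v⟩ ⟨hz : z ∈ (grChart e).source, -⟩
    simp [hz]
  open_target := (isOpen_source e).prod isOpen_univ
  baseSet := (grChart e).source
  open_baseSet := isOpen_source e
  source_eq := rfl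
  target_eq := rfl
  proj_toFun _ _ := rfl

theorem pretriv_apply (a : Frames F E) (e : Split n) (z : Gr n) (h : z ∈ (grChart e).source)
    (v : E z) : a.pretriv e ⟨z, v⟩ = (z, a.triv e z h v) := by
  change (z, _) = _
  simp [h]

theorem pretriv_symm_apply (a : Frames F E) (e : Split n) (z : Gr n)
    (h : z ∈ (grChart e).source) (v : F) :
    (a.pretriv e).symm z v = (a.triv e z h).symm v := by
  have h' : z ∈ (a.pretriv e).baseSet := h
  rw [Pretrivialization.symm_apply _ h']
  apply (a.triv e z h).injective
  rw [LinearEquiv.apply_symm_apply]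
  have := (a.pretriv e).apply_mk_symm h' v
  rw [Pretrivialization.symm_apply _ h', pretriv_apply a e z h] at this
  exact (Prod.ext_iff.1 this).2

theorem change_eq (a : Frames F E) (e e' : Split n) (z : Gr n)
    (h : z ∈ (grChart e).source ∩ (grChart e').source) (v : F) :
    a.change e e' (grChart e z) v = (a.pretriv e' ⟨z, (a.pretriv e).symm z v⟩).2 := by
  rw [a.pretriv_symm_apply e z h.1, a.pretriv_apply e' z h.2, a.change_apply e e' z h.1 h.2]

theorem contMDiffOn_change (a : Frames F E) (e e' : Split n) :
    ContMDiffOn 𝓘(ℂ, M n) 𝓘(ℂ, F →L[ℂ] F) ω (fun z => a.change e e' (grChart e z))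
      ((grChart e).source ∩ (grChart e').source) :=
  (a.contDiff_change e e').contMDiff.comp_contMDiffOn
    ((contMDiffOn_grChart e).mono inter_subset_left)

/-- The vector bundle defined by the local trivializations. -/
def prebundle (a : Frames F E) : VectorPrebundle ℂ F E where
  pretrivializationAtlas := Set.range a.pretriv
  pretrivialization_linear' := by
    rintro _ ⟨e, rfl⟩
    refine ⟨fun z hz => ⟨fun v w => ?_, fun c v => ?_⟩⟩
    all_goals
      have hz' : z ∈ (grChart e).source := hz
      simp [a.pretriv_apply e z hz']
  pretrivializationAt z := a.pretriv (splitAt z)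
  mem_base_pretrivializationAt := mem_splitAt
  pretrivialization_mem_atlas z := ⟨_, rfl⟩
  exists_coordChange := by
    rintro _ ⟨e, rfl⟩ _ ⟨e', rfl⟩
    exact ⟨_, (a.contMDiffOn_change e e').continuousOn, a.change_eq e e'⟩
  totalSpaceMk_isInducing z := by
    have h := mem_splitAt z
    have : (a.pretriv (splitAt z) ∘ TotalSpace.mk z : E z → Gr n × F) =
        (fun v => (z, v)) ∘ a.triv (splitAt z) z h := by
      ext1 v
      exact a.pretriv_apply _ z h v
    rw [this]
    exact (isInducing_prodMkRight z).comp (a.isInducing _ z h)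

theorem isContMDiff (a : Frames F E) : a.prebundle.IsContMDiff 𝓘(ℂ, M n) ω where
  exists_contMDiffCoordChange := by
    rintro _ ⟨e, rfl⟩ _ ⟨e', rfl⟩
    exact ⟨_, a.contMDiffOn_change e e', a.change_eq e e'⟩

end Frames

/-! ### The bundles `E`, `E^⊥`, `E ⊗ E^⊥` and `N` -/

/-- The fibre `E_z = z` of the tautological bundle. -/
abbrev EFib (z : Gr n) : Type := z.space

instance (z : Gr n) : AddCommGroup (EFib z) := z.space.addCommGroup
instance (z : Gr n) : Module ℂ (EFib z) := z.space.module

/-- The annihilator of `z` in the dual of `ℂ²ⁿ`. -/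
def annih (z : Gr n) : Submodule ℂ (V n →L[ℂ] ℂ) where
  carrier := {φ | ∀ w ∈ z.space, φ w = 0}
  zero_mem' := fun _ _ => rfl
  add_mem' := fun h h' w hw => by simp [h w hw, h' w hw]
  smul_mem' := fun c φ h w hw => by simp [h w hw]

/-- The fibre of `E^⊥`: the functionals on `ℂ²ⁿ` vanishing on `z`. -/
abbrev PFib (z : Gr n) : Type := annih z

instance (z : Gr n) : AddCommGroup (PFib z) := (annih z).addCommGroup
instance (z : Gr n) : Module ℂ (PFib z) := (annih z).module

/-- The fibre of the tensor product bundle `E ⊗ E^⊥`. -/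
def EPFib (z : Gr n) : Type := EFib z ⊗[ℂ] PFib z

instance (z : Gr n) : AddCommGroup (EPFib z) := inferInstanceAs (AddCommGroup (EFib z ⊗[ℂ] PFib z))
instance (z : Gr n) : Module ℂ (EPFib z) := inferInstanceAs (Module ℂ (EFib z ⊗[ℂ] PFib z))
/-- The canonical topology of a finite dimensional complex vector space. -/
instance (z : Gr n) : TopologicalSpace (EPFib z) := moduleTopology ℂ (EPFib z)
instance (z : Gr n) : IsModuleTopology ℂ (EPFib z) := ⟨rfl⟩

/-- The linear maps `Z` of `ℂ²ⁿ` with `Im Z ⊆ z ⊆ Ker Z`. -/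
def nilp (z : Gr n) : Submodule ℂ (gl n) where
  carrier := {Z | LinearMap.range (Z : V n →ₗ[ℂ] V n) ≤ z.space ∧
    z.space ≤ LinearMap.ker (Z : V n →ₗ[ℂ] V n)}
  zero_mem' := ⟨by rintro _ ⟨v, rfl⟩; exact z.space.zero_mem, fun _ _ => rfl⟩
  add_mem' := by
    rintro Z Z' ⟨h1, h2⟩ ⟨h1', h2'⟩
    constructor
    · rintro _ ⟨v, rfl⟩
      exact z.space.add_mem (h1 ⟨v, rfl⟩) (h1' ⟨v, rfl⟩)
    · intro w hw
      have a : Z w = 0 := h2 hw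
      have b : Z' w = 0 := h2' hw
      change Z w + Z' w = 0
      rw [a, b, add_zero]
  smul_mem' := by
    rintro c Z ⟨h1, h2⟩
    constructor
    · rintro _ ⟨v, rfl⟩
      exact z.space.smul_mem c (h1 ⟨v, rfl⟩)
    · intro w hw
      have a : Z w = 0 := h2 hw
      change c • Z w = 0
      rw [a, smul_zero]

/-- The fibre `N_z` of the bundle of nilpotent elements. -/
abbrev NFib (z : Gr n) : Type := nilp z

instance (z : Gr n) : AddCommGroup (NFib z) := (nilp z).addCommGroup
instance (z : Gr n) : Module ℂ (NFib z) := (nilp z).module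

/-- The map `w ↦ (e w)₂ - A (e w)₁`, whose kernel is the graph of `A`. -/
def coker (e : Split n) (A : M n) : V n →L[ℂ] K n :=
  (ContinuousLinearMap.snd ℂ (K n) (K n) - A ∘L ContinuousLinearMap.fst ℂ (K n) (K n)) ∘L
    (e : V n →L[ℂ] K n × K n)

theorem coker_apply (e : Split n) (A : M n) (w : V n) : coker e A w = (e w).2 - A (e w).1 := rfl

theorem contDiff_coker (e : Split n) : ContDiff ℂ ω (coker e) := by
  unfold coker
  fun_prop

/-- The inclusion `y ↦ e⁻¹(0, y)` of the second summand of a splitting. -/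
def inr (e : Split n) : K n →L[ℂ] V n :=
  (e.symm : K n × K n →L[ℂ] V n) ∘L ContinuousLinearMap.inr ℂ (K n) (K n)

theorem inr_apply (e : Split n) (y : K n) : inr e y = e.symm (0, y) := rfl

theorem sub_inr_coker_mem {e : Split n} {z : Gr n} (h : z ∈ (grChart e).source) (w : V n) :
    w - inr e (coker e (grChart e z) w) ∈ z.space := by
  rw [mem_iff_of_mem_source h]
  simp [inr_apply, coker_apply]

theorem coker_eq_zero {e : Split n} {z : Gr n} (h : z ∈ (grChart e).source) {w : V n}
    (hw : w ∈ z.space) : coker e (grChart e z) w = 0 := by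
  rw [coker_apply, sub_eq_zero]
  exact (mem_iff_of_mem_source h).1 hw

theorem coker_inr (e : Split n) (A : M n) (y : K n) : coker e A (inr e y) = y := by
  simp [inr_apply, coker_apply]

theorem graphMap_mem {e : Split n} {z : Gr n} (h : z ∈ (grChart e).source) (k : K n) :
    graphMap e (grChart e z) k ∈ z.space := by
  rw [mem_iff_of_mem_source h]; simp [graphMap_apply]

theorem graphMap_fst {e : Split n} {z : Gr n} (h : z ∈ (grChart e).source) {w : V n}
    (hw : w ∈ z.space) : graphMap e (grChart e z) (e w).1 = w := by
  rw [graphMap_apply, ← (mem_iff_of_mem_source h).1 hw]; simp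

/-- The trivialization `w ↦ (e w)₁` of the tautological bundle over a chart domain. -/
def trivE (e : Split n) (z : Gr n) (h : z ∈ (grChart e).source) : EFib z ≃ₗ[ℂ] K n where
  toFun w := (e w.1).1
  map_add' w w' := by simp
  map_smul' c w := by simp
  invFun k := ⟨graphMap e (grChart e z) k, graphMap_mem h k⟩
  left_inv w := Subtype.ext (graphMap_fst h w.2)
  right_inv k := by simp [graphMap_apply]

/-- The trivialization of `E^⊥` over a chart domain: a functional `φ` vanishing on `z` is sent to
the coordinates of the functional `y ↦ φ (e⁻¹(0, y))` on `ℂⁿ`. -/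
def trivP (e : Split n) (z : Gr n) (h : z ∈ (grChart e).source) : PFib z ≃ₗ[ℂ] K n where
  toFun φ := fun j => φ.1 (inr e (Pi.single j 1))
  map_add' φ ψ := rfl
  map_smul' c φ := rfl
  invFun c := ⟨(∑ j, c j • ContinuousLinearMap.proj j) ∘L coker e (grChart e z), fun w hw => by
    rw [ContinuousLinearMap.comp_apply, coker_eq_zero h hw, map_zero]⟩
  left_inv φ := by
    ext1
    ext1 w
    have h1 := φ.2 _ (sub_inr_coker_mem h w)
    rw [map_sub, sub_eq_zero] at h1
    rw [h1]
    have h2 := LinearMap.pi_apply_eq_sum_univ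
      ((φ.1 ∘L inr e : K n →L[ℂ] ℂ) : K n →ₗ[ℂ] ℂ) (coker e (grChart e z) w)
    change φ.1 (inr e (coker e (grChart e z) w)) = _ at h2
    rw [h2]
    simp only [ContinuousLinearMap.comp_apply, sum_apply,
      smul_apply, ContinuousLinearMap.proj_apply, smul_eq_mul]
    refine Finset.sum_congr rfl fun j _ => ?_
    rw [mul_comm]
    have h3 : (Pi.single j 1 : K n) = fun i => if j = i then 1 else 0 := by
      ext i
      simp [Pi.single_apply, eq_comm]
    rw [h3]
    rfl
  right_inv c := by
    ext j
    simp [coker_inr, Pi.single_apply]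

/-- The tensor product of the trivializations of `E` and of `E^⊥`. -/
def trivEP (e : Split n) (z : Gr n) (h : z ∈ (grChart e).source) :
    EPFib z ≃ₗ[ℂ] (Fin n × Fin n → ℂ) :=
  (TensorProduct.congr (trivE e z h) (trivP e z h)).trans
    ((Pi.basisFun ℂ (Fin n)).tensorProduct (Pi.basisFun ℂ (Fin n))).equivFun

/-- The trivialization `Z ↦ (y ↦ (e (Z (e⁻¹(0, y))))₁)` of `N` over a chart domain. -/
def trivN (e : Split n) (z : Gr n) (h : z ∈ (grChart e).source) : NFib z ≃ₗ[ℂ] M n where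
  toFun Z := ContinuousLinearMap.fst ℂ (K n) (K n) ∘L (e : V n →L[ℂ] K n × K n) ∘L Z.1 ∘L inr e
  map_add' Z Z' := by ext; simp
  map_smul' c Z := by ext; simp
  invFun Y := ⟨graphMap e (grChart e z) ∘L Y ∘L coker e (grChart e z), by
    constructor
    · rintro _ ⟨v, rfl⟩
      exact graphMap_mem h _
    · intro w hw
      change graphMap e (grChart e z) (Y (coker e (grChart e z) w)) = 0
      rw [coker_eq_zero h hw, map_zero, map_zero]⟩
  left_inv Z := by
    ext1
    refine ContinuousLinearMap.ext fun w => ?_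
    change graphMap e (grChart e z) (e (Z.1 (inr e (coker e (grChart e z) w)))).1 = Z.1 w
    have h0 : ∀ v, graphMap e (grChart e z) (e (Z.1 v)).1 = Z.1 v := fun v =>
      graphMap_fst h (Z.2.1 ⟨v, rfl⟩)
    rw [h0]
    have h1 : Z.1 (w - inr e (coker e (grChart e z) w)) = 0 := Z.2.2 (sub_inr_coker_mem h w)
    rw [map_sub, sub_eq_zero] at h1
    exact h1.symm
  right_inv Y := by
    refine ContinuousLinearMap.ext fun y => ?_
    change (e (graphMap e (grChart e z) (Y (coker e (grChart e z) (inr e y))))).1 = Y y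
    rw [coker_inr, graphMap_apply]
    simp

theorem isInducing_of_linearEquiv {E F : Type} [AddCommGroup E] [Module ℂ E] [TopologicalSpace E]
    [IsTopologicalAddGroup E] [ContinuousSMul ℂ E] [T2Space E] [FiniteDimensional ℂ E]
    [NormedAddCommGroup F] [NormedSpace ℂ F] (f : E ≃ₗ[ℂ] F) : IsInducing f :=
  f.toContinuousLinearEquiv.toHomeomorph.isInducing

theorem isInducing_of_linearEquiv' {E F : Type} [AddCommGroup E] [Module ℂ E] [TopologicalSpace E]
    [IsModuleTopology ℂ E] [NormedAddCommGroup F] [NormedSpace ℂ F] [FiniteDimensional ℂ F]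
    (f : E ≃ₗ[ℂ] F) : IsInducing f := by
  have : IsTopologicalAddGroup E := IsModuleTopology.topologicalAddGroup ℂ E
  have : ContinuousAdd E := IsModuleTopology.toContinuousAdd ℂ E
  let g : E ≃ₜ F :=
    { f.toEquiv with
      continuous_toFun := IsModuleTopology.continuous_of_linearMap (f : E →ₗ[ℂ] F)
      continuous_invFun := LinearMap.continuous_of_finiteDimensional (f.symm : F →ₗ[ℂ] E) }
  exact g.isInducing

/-- The transpose of a matrix. -/
def transp (n : ℕ) : M n →ₗ[ℂ] M n where
  toFun B := ContinuousLinearMap.pi fun j => ∑ i, B (Pi.single j 1) i • ContinuousLinearMap.proj i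
  map_add' B B' := by ext; simp [add_mul, Finset.sum_add_distrib]
  map_smul' c B := by ext; simp [Finset.mul_sum, mul_assoc]

/-- The block of the transition maps which acts on the annihilators. -/
def blockD (e e' : Split n) (A : M n) : M n := coker e A ∘L inr e'

theorem contDiff_blockD (e e' : Split n) : ContDiff ℂ ω (blockD e e') := by
  unfold blockD
  have := contDiff_coker e
  fun_prop

/-- The transition maps of the bundle of annihilators. -/
def changeP (e e' : Split n) (A : M n) : M n :=
  LinearMap.toContinuousLinearMap (transp n) (blockD e e' A)

theorem contDiff_changeP (e e' : Split n) : ContDiff ℂ ω (changeP e e') :=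
  (LinearMap.toContinuousLinearMap (transp n)).contDiff.comp (contDiff_blockD e e')

theorem changeP_apply (e e' : Split n) (z : Gr n) (h : z ∈ (grChart e).source)
    (h' : z ∈ (grChart e').source) (v : K n) :
    changeP e e' (grChart e z) v = trivP e' z h' ((trivP e z h).symm v) := by
  ext j
  change (∑ i, blockD e e' (grChart e z) (Pi.single j 1) i •
    (ContinuousLinearMap.proj i : K n →L[ℂ] ℂ)) v =
    (∑ i, v i • (ContinuousLinearMap.proj i : K n →L[ℂ] ℂ)) (coker e (grChart e z)
      (inr e' (Pi.single j 1)))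
  simp [blockD, mul_comm]

/-- The tensor product of two matrices. -/
def kron (n : ℕ) :
    M n →L[ℂ] M n →L[ℂ] ((Fin n × Fin n → ℂ) →L[ℂ] (Fin n × Fin n → ℂ)) :=
  LinearMap.toContinuousBilinearMap <| LinearMap.mk₂ ℂ
    (fun B C => LinearMap.toContinuousLinearMap
      ((((Pi.basisFun ℂ (Fin n)).tensorProduct (Pi.basisFun ℂ (Fin n))).equivFun : _ →ₗ[ℂ] _) ∘ₗ
        TensorProduct.map (B : K n →ₗ[ℂ] K n) (C : K n →ₗ[ℂ] K n) ∘ₗ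
        (((Pi.basisFun ℂ (Fin n)).tensorProduct (Pi.basisFun ℂ (Fin n))).equivFun.symm :
          _ →ₗ[ℂ] _)))
    (by intros; simp [TensorProduct.map_add_left, LinearMap.add_comp, LinearMap.comp_add])
    (by intros; simp [TensorProduct.map_smul_left, LinearMap.smul_comp, LinearMap.comp_smul])
    (by intros; simp [TensorProduct.map_add_right, LinearMap.add_comp, LinearMap.comp_add])
    (by intros; simp [TensorProduct.map_smul_right, LinearMap.smul_comp, LinearMap.comp_smul])

theorem tensor_change {E P : Type} [AddCommGroup E] [Module ℂ E] [AddCommGroup P] [Module ℂ P]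
    (f f' : E ≃ₗ[ℂ] K n) (g g' : P ≃ₗ[ℂ] K n) {B C : M n}
    (hB : ∀ v, B v = f' (f.symm v)) (hC : ∀ v, C v = g' (g.symm v)) (v : Fin n × Fin n → ℂ) :
    kron n B C v =
      ((TensorProduct.congr f' g').trans
        ((Pi.basisFun ℂ (Fin n)).tensorProduct (Pi.basisFun ℂ (Fin n))).equivFun)
      (((TensorProduct.congr f g).trans
        ((Pi.basisFun ℂ (Fin n)).tensorProduct (Pi.basisFun ℂ (Fin n))).equivFun).symm v) := by
  have h1 : (B : K n →ₗ[ℂ] K n) = (f' : E →ₗ[ℂ] K n) ∘ₗ (f.symm : K n →ₗ[ℂ] E) :=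
    LinearMap.ext hB
  have h2 : (C : K n →ₗ[ℂ] K n) = (g' : P →ₗ[ℂ] K n) ∘ₗ (g.symm : K n →ₗ[ℂ] P) :=
    LinearMap.ext hC
  change ((Pi.basisFun ℂ (Fin n)).tensorProduct (Pi.basisFun ℂ (Fin n))).equivFun
    (TensorProduct.map (B : K n →ₗ[ℂ] K n) (C : K n →ₗ[ℂ] K n)
      (((Pi.basisFun ℂ (Fin n)).tensorProduct (Pi.basisFun ℂ (Fin n))).equivFun.symm v)) = _
  rw [h1, h2, TensorProduct.map_comp]
  rfl

/-- The tautological bundle `E`. -/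
def framesE (n : ℕ) : Frames (K n) (EFib (n := n)) where
  triv := trivE
  isInducing e z h := isInducing_of_linearEquiv (trivE e z h)
  change := blockA
  contDiff_change := contDiff_blockA
  change_apply _ _ _ _ _ _ := rfl

/-- The bundle `E^⊥`. -/
def framesP (n : ℕ) : Frames (K n) (PFib (n := n)) where
  triv := trivP
  isInducing e z h := isInducing_of_linearEquiv (trivP e z h)
  change := changeP
  contDiff_change := contDiff_changeP
  change_apply := changeP_apply

/-- The tensor product bundle `E ⊗ E^⊥`. -/
def framesEP (n : ℕ) : Frames (Fin n × Fin n → ℂ) (EPFib (n := n)) where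
  triv := trivEP
  isInducing e z h := isInducing_of_linearEquiv' (trivEP e z h)
  change e e' A := kron n (blockA e e' A) (changeP e e' A)
  contDiff_change e e' := by
    have h1 := contDiff_blockA e e'
    have h2 := contDiff_changeP e e'
    fun_prop
  change_apply e e' z h h' v := by
    exact tensor_change (trivE e z h) (trivE e' z h') (trivP e z h) (trivP e' z h')
      (fun _ => rfl) (changeP_apply e e' z h h') v

/-- The bundle `N` of nilpotent elements. -/
def framesN (n : ℕ) : Frames (M n) (NFib (n := n)) where
  triv := trivN
  isInducing e z h := isInducing_of_linearEquiv (trivN e z h)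
  change e e' A :=
    (ContinuousLinearMap.compL ℂ (K n) (K n) (K n) (blockA e e' A)) ∘L
      ((ContinuousLinearMap.compL ℂ (K n) (K n) (K n)).flip (blockD e e' A))
  contDiff_change e e' := by
    have h1 := contDiff_blockA e e'
    have h2 := contDiff_blockD e e'
    fun_prop
  change_apply e e' z h h' Y := rfl

instance : TopologicalSpace (TotalSpace (K n) (EFib (n := n))) :=
  (framesE n).prebundle.totalSpaceTopology
instance : FiberBundle (K n) (EFib (n := n)) := (framesE n).prebundle.toFiberBundle
instance : VectorBundle ℂ (K n) (EFib (n := n)) := (framesE n).prebundle.toVectorBundle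
instance : ContMDiffVectorBundle ω (K n) (EFib (n := n)) 𝓘(ℂ, M n) :=
  have := (framesE n).isContMDiff
  (framesE n).prebundle.contMDiffVectorBundle (n := ω) (IB := 𝓘(ℂ, M n))

instance : TopologicalSpace (TotalSpace (K n) (PFib (n := n))) :=
  (framesP n).prebundle.totalSpaceTopology
instance : FiberBundle (K n) (PFib (n := n)) := (framesP n).prebundle.toFiberBundle
instance : VectorBundle ℂ (K n) (PFib (n := n)) := (framesP n).prebundle.toVectorBundle
instance : ContMDiffVectorBundle ω (K n) (PFib (n := n)) 𝓘(ℂ, M n) :=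
  have := (framesP n).isContMDiff
  (framesP n).prebundle.contMDiffVectorBundle (n := ω) (IB := 𝓘(ℂ, M n))

instance : TopologicalSpace (TotalSpace (Fin n × Fin n → ℂ) (EPFib (n := n))) :=
  (framesEP n).prebundle.totalSpaceTopology
instance : FiberBundle (Fin n × Fin n → ℂ) (EPFib (n := n)) := (framesEP n).prebundle.toFiberBundle
instance : VectorBundle ℂ (Fin n × Fin n → ℂ) (EPFib (n := n)) :=
  (framesEP n).prebundle.toVectorBundle
instance : ContMDiffVectorBundle ω (Fin n × Fin n → ℂ) (EPFib (n := n)) 𝓘(ℂ, M n) :=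
  have := (framesEP n).isContMDiff
  (framesEP n).prebundle.contMDiffVectorBundle (n := ω) (IB := 𝓘(ℂ, M n))

instance : TopologicalSpace (TotalSpace (M n) (NFib (n := n))) :=
  (framesN n).prebundle.totalSpaceTopology
instance : FiberBundle (M n) (NFib (n := n)) := (framesN n).prebundle.toFiberBundle
instance : VectorBundle ℂ (M n) (NFib (n := n)) := (framesN n).prebundle.toVectorBundle
instance : ContMDiffVectorBundle ω (M n) (NFib (n := n)) 𝓘(ℂ, M n) :=
  have := (framesN n).isContMDiff
  (framesN n).prebundle.contMDiffVectorBundle (n := ω) (IB := 𝓘(ℂ, M n))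

/-! ### The cotangent bundle -/

/-- The fibre of the holomorphic cotangent bundle of the Grassmannian, which is the bundle of
linear maps from the tangent bundle to the trivial line bundle. -/
abbrev CotFib (z : Gr n) : Type :=
  TangentSpace 𝓘(ℂ, M n) z →L[ℂ] Bundle.Trivial (Gr n) ℂ z

/-! ### The actions of `GL(2n, ℂ)` -/

/-- The map `w ↦ g w` from `z` to `g z`. -/
def actE (g : GL2 n) (z : Gr n) : EFib z →ₗ[ℂ] EFib (g • z) where
  toFun w := ⟨g w.1, mem_smul_of_mem g w.2⟩
  map_add' w w' := Subtype.ext (map_add g w.1 w'.1)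
  map_smul' c w := Subtype.ext (map_smul g c w.1)

/-- The map `φ ↦ φ ∘ g⁻¹` from the annihilator of `z` to that of `g z`. -/
def actP (g : GL2 n) (z : Gr n) : PFib z →ₗ[ℂ] PFib (g • z) where
  toFun φ := ⟨φ.1 ∘L (g.symm : V n →L[ℂ] V n), fun _ hw => φ.2 _ (inv_mem_of_mem_smul g hw)⟩
  map_add' _ _ := rfl
  map_smul' _ _ := rfl

/-- The action on `E ⊗ E^⊥`. -/
def actEP (g : GL2 n) (z : Gr n) : EPFib z →ₗ[ℂ] EPFib (g • z) :=
  TensorProduct.map (actE g z) (actP g z)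

/-- The map `Z ↦ g Z g⁻¹` from `N_z` to `N_{g z}`. -/
def actN (g : GL2 n) (z : Gr n) : NFib z →ₗ[ℂ] NFib (g • z) where
  toFun Z := ⟨(g : V n →L[ℂ] V n) ∘L Z.1 ∘L (g.symm : V n →L[ℂ] V n), by
    constructor
    · rintro _ ⟨v, rfl⟩
      exact mem_smul_of_mem g (Z.2.1 ⟨g.symm v, rfl⟩)
    · intro w hw
      have h : Z.1 (g.symm w) = 0 := Z.2.2 (inv_mem_of_mem_smul g hw)
      change g (Z.1 (g.symm w)) = 0
      rw [h, map_zero]⟩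
  map_add' Z Z' := by ext; simp
  map_smul' c Z := by ext; simp

/-- The cotangent lift of `σ_g : z ↦ g z`, that is `α ↦ α ∘ (dσ_g(z))⁻¹`. -/
def actCot (g : GL2 n) (z : Gr n) : CotFib z →ₗ[ℂ] CotFib (g • z) where
  toFun α := α ∘L (mfderiv 𝓘(ℂ, M n) 𝓘(ℂ, M n) (fun z : Gr n => g • z) z).inverse
  map_add' _ _ := rfl
  map_smul' _ _ := rfl

section Bundles

variable {F : Type} {E : Gr n → Type} [∀ z, AddCommGroup (E z)] [∀ z, Module ℂ (E z)]

/-- The map of the total space of a bundle over `σ_g` given by linear maps of the fibres. -/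
def totalAct (F : Type) (ρ : ∀ (g : GL2 n) (z : Gr n), E z →ₗ[ℂ] E (g • z)) (g : GL2 n)
    (x : TotalSpace F E) : TotalSpace F E :=
  ⟨g • x.1, ρ g x.1 x.2⟩

/-- The orbit of a point of the total space. -/
def orbit (ρ : ∀ (g : GL2 n) (z : Gr n), E z →ₗ[ℂ] E (g • z)) (x : TotalSpace F E) :
    Set (TotalSpace F E) :=
  Set.range fun g => totalAct F ρ g x

/-- The total space is the disjoint union of the sets `S 0, …, S n`, and each of them is an
orbit. -/
def SplitsIntoOrbits (ρ : ∀ (g : GL2 n) (z : Gr n), E z →ₗ[ℂ] E (g • z))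
    (S : ℕ → Set (TotalSpace F E)) : Prop :=
  (∀ x, ∃! k, k ≤ n ∧ x ∈ S k) ∧ ∀ k ≤ n, ∃ x, S k = orbit ρ x

variable [∀ z, TopologicalSpace (E z)]

/-- The maps `ρ g` define an action of `GL(2n, ℂ)` on a holomorphic vector bundle by holomorphic
vector bundle automorphisms over the maps `σ_g`. -/
structure IsVectorBundleAction (F : Type) [NormedAddCommGroup F] [NormedSpace ℂ F]
    [TopologicalSpace (TotalSpace F E)] [FiberBundle F E] [VectorBundle ℂ F E]
    (ρ : ∀ (g : GL2 n) (z : Gr n), E z →ₗ[ℂ] E (g • z)) : Prop where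
  one (x : TotalSpace F E) : totalAct F ρ 1 x = x
  mul (g h : GL2 n) (x : TotalSpace F E) : totalAct F ρ (g * h) x = totalAct F ρ g (totalAct F ρ h x)
  holomorphic (g : GL2 n) : ContMDiff (𝓘(ℂ, M n).prod 𝓘(ℂ, F)) (𝓘(ℂ, M n).prod 𝓘(ℂ, F)) ω
    (totalAct F ρ g)

variable {E' : Gr n → Type}
  [∀ z, AddCommGroup (E' z)] [∀ z, Module ℂ (E' z)] [∀ z, TopologicalSpace (E' z)]

/-- The map of total spaces given by linear isomorphisms of the fibres. -/
def totalMap (F F' : Type) (f : ∀ z, E z ≃ₗ[ℂ] E' z) (x : TotalSpace F E) : TotalSpace F' E' :=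
  ⟨x.1, f x.1 x.2⟩

/-- The linear isomorphisms `f z` of the fibres form an isomorphism of holomorphic vector
bundles: the resulting map of total spaces is biholomorphic. -/
structure IsVectorBundleIso (F F' : Type) [NormedAddCommGroup F] [NormedSpace ℂ F]
    [TopologicalSpace (TotalSpace F E)] [FiberBundle F E] [VectorBundle ℂ F E]
    [NormedAddCommGroup F'] [NormedSpace ℂ F']
    [TopologicalSpace (TotalSpace F' E')] [FiberBundle F' E'] [VectorBundle ℂ F' E']
    (f : ∀ z, E z ≃ₗ[ℂ] E' z) : Prop where
  holomorphic : ContMDiff (𝓘(ℂ, M n).prod 𝓘(ℂ, F)) (𝓘(ℂ, M n).prod 𝓘(ℂ, F')) ω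
    (totalMap F F' f)
  holomorphic_symm : ContMDiff (𝓘(ℂ, M n).prod 𝓘(ℂ, F')) (𝓘(ℂ, M n).prod 𝓘(ℂ, F)) ω
    (totalMap F' F fun z => (f z).symm)

end Bundles

/-! ### The explicit form of the isomorphisms -/

open Classical in
/-- The chart `φ_p(z) = q_z - p` attached to an idempotent `p`, as a map into `gl(2n, ℂ)`: if
`ℂ²ⁿ = z ⊕ Ker p`, then `q_z` is the projection onto `z` along `Ker p`. -/
def phi (p : gl n) (z : Gr n) : gl n :=
  if h : IsCompl z.space (LinearMap.ker (p : V n →ₗ[ℂ] V n)) then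
    LinearMap.toContinuousLinearMap (Submodule.projection _ _ h) - p
  else 0

/-- The element `v ↦ φ(v) w` of `gl(2n, ℂ)`. -/
def rankOne (w : V n) (φ : V n →L[ℂ] ℂ) : gl n := φ.smulRight w

/-- The trace form `(Z₁, Z₂) ↦ Tr (Z₁ Z₂)` on `gl(2n, ℂ)`. -/
def traceForm (Z₁ Z₂ : gl n) : ℂ := LinearMap.trace ℂ (V n) ((Z₁ ∘L Z₂ : gl n) : V n →ₗ[ℂ] V n)

/-- The set `N^k` of the points `(Z, z)` of `N` with `rank Z = k`. -/
def NOrbit (n k : ℕ) : Set (TotalSpace (M n) (NFib (n := n))) :=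
  {x | Module.finrank ℂ (LinearMap.range (x.2.1 : V n →ₗ[ℂ] V n)) = k}

end GrBundles
end

open GrBundles

namespace GrBundles

set_option maxSynthPendingDepth 3
set_option linter.unusedSectionVars false

variable {n : ℕ}

/-! ### Transition maps and their derivatives -/

/-! Everything is computed in the affine charts. Let `e` be a splitting in which z is the graph of
A. The map k ↦ e⁻¹(k, Ak) identifies ℂⁿ with z, and `coker e A` identifies ℂ²ⁿ/z with ℂⁿ. An element
Z of N_z kills z and lands in z, so it is the same as a matrix Y = `trivN e z h Z`. A tangent vector
is a matrix X, thought of as a map z → ℂ²ⁿ/z. Passing to another splitting changes these to Y' =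
aYd⁻¹ and X' = dXa⁻¹, where a and d are the coordinate changes on z and on ℂ²ⁿ/z. Hence Tr(Y'X') =
Tr(YX): the trace pairing does not depend on the chart. It is nondegenerate, and it has the same
expression in every trivialization, so it is a holomorphic isomorphism of N with the cotangent
bundle (`tr_trivN_comp_fderiv_transition`, `isVectorBundleIso_toCot`). In the same way, v ↦ φ(v)w
has matrix entries wᵢφⱼ, so the comparison with the tensor product is constant in the
trivializations (`entries_trivN_ofTensor`).

The formula with an idempotent p comes from differentiating the condition that q_z w lies in z:
modulo z, dφ_p(X) is X applied to the coordinate of pw in z. Since p is the identity on its image,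
cyclicity of the trace turns Tr(Z dφ_p(X)) into Tr(YX) (`traceForm_fderiv_phi`).

For equivariance, g carries the chart of `e` to that of e ∘ g⁻¹ without changing the coordinates of
z or of Z, so chart independence of the pairing already contains invariance under g. The action
axioms and the orbits are settled on N and transported along the isomorphisms.

For the orbits, choose splittings in which z and z' are graphs of 0. Then Z and Z' have a single
nonzero block, Y and Y', of the same rank as Z and Z'. Matrices of equal rank satisfy PY = Y'Q with
P, Q invertible, and the block diagonal map (P, Q) is the required g (`exists_totalAct_eq`). -/

theorem mem_source_graph (e : Split n) (A : M n) : graph e A ∈ (grChart e).source := ⟨A, rfl⟩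

theorem grChart_graph (e : Split n) (A : M n) : grChart e (graph e A) = A :=
  (grChart e).right_inv (mem_univ A)

theorem graph_grChart {e : Split n} {z : Gr n} (h : z ∈ (grChart e).source) :
    graph e (grChart e z) = z :=
  (grChart e).left_inv h

theorem contMDiff_graph (e : Split n) : ContMDiff 𝓘(ℂ, M n) 𝓘(ℂ, M n) ω (graph e) := by
  have h := contMDiffOn_symm_of_mem_maximalAtlas
    (I := 𝓘(ℂ, M n)) (n := ω) (e := (grCore n).openPartialHomeomorph (grChart e) ⟨e, rfl⟩)
    (IsManifold.subset_maximalAtlas ((mem_atlas_iff _).2 ⟨e, rfl⟩))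
  exact contMDiffOn_univ.1 h

/-- The change of coordinates from the chart of `e` to the chart of `e'`. -/
noncomputable def transition (e e' : Split n) (A : M n) : M n := grChart e' (graph e A)

theorem eventually_mem_source {e e' : Split n} {A : M n}
    (h : graph e A ∈ (grChart e').source) : ∀ᶠ B in 𝓝 A, graph e B ∈ (grChart e').source :=
  (contMDiff_graph e).continuous.continuousAt.eventually_mem ((isOpen_source e').mem_nhds h)

theorem contDiffAt_transition {e e' : Split n} {A : M n}
    (h : graph e A ∈ (grChart e').source) : ContDiffAt ℂ ω (transition e e') A :=
  (contDiffOn_trans e e').contDiffAt ((isOpen_trans_source e e').mem_nhds ⟨mem_univ A, h⟩)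

theorem differentiableAt_transition {e e' : Split n} {A : M n}
    (h : graph e A ∈ (grChart e').source) : DifferentiableAt ℂ (transition e e') A :=
  (contDiffAt_transition h).differentiableAt (by simp)

theorem graphMap_add_smul (e : Split n) (A X : M n) (t : ℂ) (k : K n) :
    graphMap e (A + t • X) k = graphMap e A k + t • inr e (X k) := by
  rw [graphMap_apply, graphMap_apply, inr_apply, ← map_smul, ← map_add]
  simp

theorem hasDerivAt_add_smul {E : Type*} [NormedAddCommGroup E] [NormedSpace ℂ E] (A X : E) :
    HasDerivAt (fun t : ℂ => A + t • X) X 0 := by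
  simpa using ((hasDerivAt_id (0 : ℂ)).smul_const X).const_add A

theorem eventually_line {E : Type*} [NormedAddCommGroup E] [NormedSpace ℂ E] {A : E} (X : E)
    {p : E → Prop} (h : ∀ᶠ B in 𝓝 A, p B) : ∀ᶠ t : ℂ in 𝓝 0, p (A + t • X) := by
  have h1 : Filter.Tendsto (fun t : ℂ => A + t • X) (𝓝 0) (𝓝 A) := by
    simpa using (hasDerivAt_add_smul A X).continuousAt.tendsto
  exact h1.eventually h

/-- This is the rule X'a = dX for tangent vectors. It follows by differentiating, along the line A +
tX, the equation saying that e⁻¹(k, (A + tX)k) lies on the graph of the transformed coordinate. -/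
theorem fderiv_transition_comp_blockA {e e' : Split n} {A : M n}
    (h : graph e A ∈ (grChart e').source) (X : M n) :
    fderiv ℂ (transition e e') A X ∘L blockA e e' A = blockD e' e (transition e e' A) ∘L X := by
  ext1 k
  have hline (t : ℂ) : graphMap e (A + t • X) k = graphMap e A k + t • inr e (X k) :=
    graphMap_add_smul e A X t k
  have h1 : HasDerivAt (fun t : ℂ => transition e e' (A + t • X))
      (fderiv ℂ (transition e e') A X) 0 :=
    (differentiableAt_transition h).hasFDerivAt.comp_hasDerivAt_of_eq 0
      (hasDerivAt_add_smul A X) (by rw [zero_smul, add_zero])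
  have h2 : HasDerivAt (fun t : ℂ => graphMap e (A + t • X) k) (inr e (X k)) 0 := by
    simpa only [hline] using hasDerivAt_add_smul (graphMap e A k) (inr e (X k))
  have h3 : HasDerivAt (fun t : ℂ => e' (graphMap e (A + t • X) k)) (e' (inr e (X k))) 0 :=
    (e' : V n →L[ℂ] K n × K n).hasFDerivAt.comp_hasDerivAt 0 h2
  have h4 : HasDerivAt (fun t : ℂ => (e' (graphMap e (A + t • X) k)).1)
      (e' (inr e (X k))).1 0 :=
    (ContinuousLinearMap.fst ℂ (K n) (K n)).hasFDerivAt.comp_hasDerivAt 0 h3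
  have h5 : HasDerivAt (fun t : ℂ => (e' (graphMap e (A + t • X) k)).2)
      (e' (inr e (X k))).2 0 :=
    (ContinuousLinearMap.snd ℂ (K n) (K n)).hasFDerivAt.comp_hasDerivAt 0 h3
  have h6 := h1.clm_apply h4
  -- The graph equation in the second chart; it holds only for small t, where the moving subspace
  -- stays in that chart.
  have h7 : (fun t : ℂ => (e' (graphMap e (A + t • X) k)).2) =ᶠ[𝓝 0]
      fun t => transition e e' (A + t • X) (e' (graphMap e (A + t • X) k)).1 := by
    filter_upwards [eventually_line X (eventually_mem_source h)] with t ht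
    exact (mem_iff_of_mem_source ht).1 ⟨k, rfl⟩
  have h8 := h5.unique (h6.congr_of_eventuallyEq h7)
  rw [zero_smul, add_zero] at h8
  change fderiv ℂ (transition e e') A X (e' (graphMap e A k)).1 =
    coker e' (transition e e' A) (inr e (X k))
  rw [coker_apply, h8]
  simp

/-- `blockD` is a coordinate change on ℂ²ⁿ/z. A vector and its representative in the second summand
of another splitting differ by an element of z, which `coker` kills. -/
theorem blockD_comp_blockD {e e' : Split n} {z : Gr n} (h : z ∈ (grChart e).source)
    (h' : z ∈ (grChart e').source) :
    blockD e e' (grChart e z) ∘L blockD e' e (grChart e' z) = ContinuousLinearMap.id ℂ (K n) := by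
  ext1 k
  change coker e (grChart e z) (inr e' (coker e' (grChart e' z) (inr e k))) = k
  have h1 := coker_eq_zero h (sub_inr_coker_mem h' (inr e k))
  rw [map_sub, coker_inr, sub_eq_zero] at h1
  exact h1.symm

/-- The rule Y' = aYd⁻¹: `blockD e e'` is the inverse of the block `blockD e' e` that acts on
tangent vectors. -/
theorem trivN_change {e e' : Split n} {z : Gr n} (h : z ∈ (grChart e).source)
    (h' : z ∈ (grChart e').source) (Z : NFib z) :
    trivN e' z h' Z =
      blockA e e' (grChart e z) ∘L trivN e z h Z ∘L blockD e e' (grChart e z) := by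
  have h1 := (framesN n).change_apply e e' z h h' (trivN e z h Z)
  change _ = trivN e' z h' ((trivN e z h).symm (trivN e z h Z)) at h1
  rw [LinearEquiv.symm_apply_apply] at h1
  rw [← h1]
  rfl

/-- If X' = 0 then dX = 0, and d has a left inverse. This gives the invertibility of dσ_g needed for
the cotangent lift. -/
theorem injective_fderiv_transition {e e' : Split n} {A : M n}
    (h : graph e A ∈ (grChart e').source) :
    Function.Injective (fderiv ℂ (transition e e') A) := by
  rw [injective_iff_map_eq_zero]
  intro X hX
  have h1 := fderiv_transition_comp_blockA h X
  rw [hX, ContinuousLinearMap.zero_comp] at h1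
  have h2 := blockD_comp_blockD (mem_source_graph e A) h
  have h3 : X = (blockD e e' (grChart e (graph e A)) ∘L
      blockD e' e (grChart e' (graph e A))) ∘L X := by
    rw [h2, ContinuousLinearMap.id_comp]
  rw [h3, ContinuousLinearMap.comp_assoc]
  change _ ∘L (blockD e' e (transition e e' A) ∘L X) = 0
  rw [← h1, ContinuousLinearMap.comp_zero]

/-! ### The trace pairing -/

/-- The trace of a matrix. -/
noncomputable def tr (n : ℕ) : M n →ₗ[ℂ] ℂ :=
  LinearMap.trace ℂ (K n) ∘ₗ ContinuousLinearMap.coeLM ℂ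

theorem tr_comp_comm (B C : M n) : tr n (B ∘L C) = tr n (C ∘L B) :=
  LinearMap.trace_mul_comm ℂ (B : K n →ₗ[ℂ] K n) (C : K n →ₗ[ℂ] K n)

/-- The trace pairing is compatible with changes of coordinates. -/
theorem tr_trivN_comp_fderiv_transition {e e' : Split n} {z : Gr n}
    (h : z ∈ (grChart e).source) (h' : z ∈ (grChart e').source) (Z : NFib z) (X : M n) :
    tr n (trivN e' z h' Z ∘L fderiv ℂ (transition e e') (grChart e z) X) =
      tr n (trivN e z h Z ∘L X) := by
  have h1 := fderiv_transition_comp_blockA (e := e) (e' := e') (A := grChart e z)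
    (by rwa [graph_grChart h]) X
  rw [transition, graph_grChart h] at h1
  rw [trivN_change h h', ContinuousLinearMap.comp_assoc, tr_comp_comm,
    ContinuousLinearMap.comp_assoc, ContinuousLinearMap.comp_assoc, h1,
    ← ContinuousLinearMap.comp_assoc (blockD e e' _), blockD_comp_blockD h h',
    ContinuousLinearMap.id_comp]

/-- Test against the rank one matrix v ↦ vᵢy: the trace of its composition with Y is (Yy)ᵢ. -/
theorem eq_zero_of_tr_comp_eq_zero {Y : M n} (h : ∀ X, tr n (Y ∘L X) = 0) : Y = 0 := by
  ext1 y
  ext i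
  have h1 := h ((ContinuousLinearMap.proj i).smulRight y)
  change LinearMap.trace ℂ (K n) ((Y : K n →ₗ[ℂ] K n) ∘ₗ
    (LinearMap.proj i : K n →ₗ[ℂ] ℂ).smulRight y) = 0 at h1
  have h2 : (Y : K n →ₗ[ℂ] K n) ∘ₗ (LinearMap.proj i : K n →ₗ[ℂ] ℂ).smulRight y =
      (LinearMap.proj i : K n →ₗ[ℂ] ℂ).smulRight (Y y) := by
    ext; simp
  rw [h2, LinearMap.trace_smulRight] at h1
  simpa using h1

/-- The linear isomorphism `Y ↦ (X ↦ Tr (Y X))`. -/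
noncomputable def traceDual (n : ℕ) : M n ≃ₗ[ℂ] (M n →L[ℂ] ℂ) :=
  LinearEquiv.ofInjectiveOfFinrankEq
    (LinearMap.toContinuousLinearMap.toLinearMap ∘ₗ
      LinearMap.mk₂ ℂ (fun Y X : M n => tr n (Y ∘L X))
        (by intros; rw [ContinuousLinearMap.add_comp, map_add])
        (by intros; rw [ContinuousLinearMap.smul_comp, map_smul])
        (by intros; rw [ContinuousLinearMap.comp_add, map_add])
        (by intros; rw [ContinuousLinearMap.comp_smul, map_smul]))
    (by
      rw [injective_iff_map_eq_zero]
      intro Y hY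
      exact eq_zero_of_tr_comp_eq_zero fun X => DFunLike.congr_fun hY X)
    (by
      rw [← (LinearMap.toContinuousLinearMap (𝕜 := ℂ) (E := M n) (F' := ℂ)).finrank_eq]
      exact (Subspace.dual_finrank_eq (K := ℂ) (V := M n)).symm)

theorem traceDual_apply (Y X : M n) : traceDual n Y X = tr n (Y ∘L X) := rfl

/-! ### Bundle maps in coordinates -/

section Coordinates

variable {F F' : Type} {E E' : Gr n → Type}
  [∀ z, AddCommGroup (E z)] [∀ z, Module ℂ (E z)] [∀ z, TopologicalSpace (E z)]
  [∀ z, AddCommGroup (E' z)] [∀ z, Module ℂ (E' z)] [∀ z, TopologicalSpace (E' z)]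
  [NormedAddCommGroup F] [NormedSpace ℂ F]
  [TopologicalSpace (TotalSpace F E)] [FiberBundle F E] [VectorBundle ℂ F E]
  [NormedAddCommGroup F'] [NormedSpace ℂ F']
  [TopologicalSpace (TotalSpace F' E')] [FiberBundle F' E'] [VectorBundle ℂ F' E']

theorem eventually_proj_mem_source (x : TotalSpace F E) :
    ∀ᶠ y : TotalSpace F E in 𝓝 x, y.1 ∈ (grChart (splitAt x.1)).source :=
  (FiberBundle.continuous_proj F E).continuousAt.eventually_mem
    ((isOpen_source _).mem_nhds (mem_splitAt x.1))

theorem contMDiffAt_coordinate (x : TotalSpace F E) :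
    ContMDiffAt (𝓘(ℂ, M n).prod 𝓘(ℂ, F)) 𝓘(ℂ, F) ω
      (fun y : TotalSpace F E => (trivializationAt F E x.1 y).2) x :=
  (contMDiffAt_totalSpace.1 (contMDiffAt_id (x := x))).2

/-- Holomorphy on a total space is tested on the base and on the fibre coordinate; here the latter
is a fixed linear map applied to the fibre coordinate of the source. -/
theorem contMDiff_totalMap (f : ∀ z, E z ≃ₗ[ℂ] E' z) (L : F →L[ℂ] F')
    (h : ∀ z₀ z : Gr n, z ∈ (grChart (splitAt z₀)).source → ∀ v : E z,
      (trivializationAt F' E' z₀ ⟨z, f z v⟩).2 = L (trivializationAt F E z₀ ⟨z, v⟩).2) :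
    ContMDiff (𝓘(ℂ, M n).prod 𝓘(ℂ, F)) (𝓘(ℂ, M n).prod 𝓘(ℂ, F')) ω (totalMap F F' f) := by
  intro x
  refine contMDiffAt_totalSpace.2 ⟨contMDiffAt_proj E, ?_⟩
  refine (L.contMDiff.contMDiffAt.comp x (contMDiffAt_coordinate x)).congr_of_eventuallyEq ?_
  filter_upwards [eventually_proj_mem_source x] with y hy
  exact h x.1 y.1 hy y.2

/-- A family of linear isomorphisms of the fibres which is constant in the distinguished
trivializations is an isomorphism of vector bundles. -/
theorem isVectorBundleIso_of_coordinates (f : ∀ z, E z ≃ₗ[ℂ] E' z) (L : F ≃L[ℂ] F')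
    (h : ∀ z₀ z : Gr n, z ∈ (grChart (splitAt z₀)).source → ∀ v : E z,
      (trivializationAt F' E' z₀ ⟨z, f z v⟩).2 = L (trivializationAt F E z₀ ⟨z, v⟩).2) :
    IsVectorBundleIso F F' f where
  holomorphic := contMDiff_totalMap f L h
  holomorphic_symm := contMDiff_totalMap _ (L.symm : F' →L[ℂ] F) fun z₀ z hz v => by
    have h1 := h z₀ z hz ((f z).symm v)
    rw [LinearEquiv.apply_symm_apply] at h1
    rw [h1]
    exact (L.symm_apply_apply _).symm

end Coordinates

theorem trivializationAt_N {z₀ z : Gr n} (h : z ∈ (grChart (splitAt z₀)).source) (Z : NFib z) :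
    (trivializationAt (M n) (NFib (n := n)) z₀ ⟨z, Z⟩).2 = trivN (splitAt z₀) z h Z :=
  (Prod.ext_iff.1 ((framesN n).pretriv_apply (splitAt z₀) z h Z)).2

theorem trivializationAt_EP {z₀ z : Gr n} (h : z ∈ (grChart (splitAt z₀)).source) (t : EPFib z) :
    (trivializationAt (Fin n × Fin n → ℂ) (EPFib (n := n)) z₀ ⟨z, t⟩).2 =
      trivEP (splitAt z₀) z h t :=
  (Prod.ext_iff.1 ((framesEP n).pretriv_apply (splitAt z₀) z h t)).2

/-- The tangent space at z is modelled through the preferred chart at z. Trivializing a covector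
over the chart at z₀ therefore means composing it with the derivative of the transition from that
chart to the preferred one. -/
theorem trivializationAt_Cot {z₀ z : Gr n} (h : z ∈ (grChart (splitAt z₀)).source)
    (α : CotFib z) (X : M n) :
    (trivializationAt (M n →L[ℂ] ℂ) (CotFib (n := n)) z₀ ⟨z, α⟩).2 X =
      α (fderiv ℂ (transition (splitAt z₀) (splitAt z)) (grChart (splitAt z₀) z) X) := by
  have h1 (c : ℂ) : (trivializationAt ℂ (Bundle.Trivial (Gr n) ℂ) z₀).continuousLinearMapAt ℂ z c = c :=
    DFunLike.congr_fun (Bundle.Trivial.continuousLinearMapAt_trivialization ℂ (Gr n) ℂ z) c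
  have h2 : (trivializationAt (M n) (TangentSpace 𝓘(ℂ, M n) (M := Gr n)) z₀).symmL ℂ z X =
      fderiv ℂ (transition (splitAt z₀) (splitAt z)) (grChart (splitAt z₀) z) X := by
    rw [TangentBundle.symmL_trivializationAt_eq_core h, tangentBundleCore_coordChange_achart]
    change fderivWithin ℂ (transition (splitAt z₀) (splitAt z)) (range id)
      (grChart (splitAt z₀) z) X = _
    rw [range_id, fderivWithin_univ]
  exact (h1 _).trans (congrArg α h2)

/-! ### The isomorphism with the cotangent bundle -/

/-- The isomorphism of `N_z` with the cotangent space at `z`, in coordinates given by the trace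
pairing. -/
noncomputable def toCot (z : Gr n) : NFib z ≃ₗ[ℂ] CotFib z :=
  (trivN (splitAt z) z (mem_splitAt z)).trans (traceDual n)

theorem toCot_apply (z : Gr n) (Z : NFib z) (X : M n) :
    toCot z Z X = tr n (trivN (splitAt z) z (mem_splitAt z) Z ∘L X) := rfl

/-- `toCot` is defined with the preferred chart at z, but chart independence of the trace pairing
gives it the same form over every chart. -/
theorem trivializationAt_toCot {z₀ z : Gr n} (h : z ∈ (grChart (splitAt z₀)).source)
    (Z : NFib z) :
    (trivializationAt (M n →L[ℂ] ℂ) (CotFib (n := n)) z₀ ⟨z, toCot z Z⟩).2 =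
      traceDual n (trivN (splitAt z₀) z h Z) := by
  ext1 X
  rw [trivializationAt_Cot h, toCot_apply, traceDual_apply]
  exact tr_trivN_comp_fderiv_transition h (mem_splitAt z) Z X

theorem isVectorBundleIso_toCot : IsVectorBundleIso (M n) (M n →L[ℂ] ℂ) (toCot (n := n)) :=
  isVectorBundleIso_of_coordinates _ (traceDual n).toContinuousLinearEquiv fun z₀ z h Z => by
    rw [trivializationAt_toCot h, trivializationAt_N h]
    rfl

/-! ### The isomorphism with the tensor product -/

/-- The matrix entries of an endomorphism of `ℂⁿ`. -/
noncomputable def entries (n : ℕ) : M n ≃ₗ[ℂ] (Fin n × Fin n → ℂ) :=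
  (LinearMap.toContinuousLinearMap.symm.trans LinearMap.toMatrix').trans
    (LinearEquiv.curry ℂ ℂ (Fin n) (Fin n)).symm

theorem entries_apply (Y : M n) (i j : Fin n) : entries n Y (i, j) = Y (Pi.single j 1) i := by
  change LinearMap.toMatrix' (Y : K n →ₗ[ℂ] K n) i j = _
  rw [LinearMap.toMatrix'_apply]
  rfl

theorem rankOne_mem {z : Gr n} (w : EFib z) (φ : PFib z) : rankOne (w : V n) φ.1 ∈ nilp z := by
  constructor
  · rintro _ ⟨v, rfl⟩
    exact z.space.smul_mem _ w.2
  · intro v hv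
    change φ.1 v • (w : V n) = 0
    rw [φ.2 v hv, zero_smul]

/-- The map `w ⊗ φ ↦ (v ↦ φ(v) w)`. -/
noncomputable def ofTensor (z : Gr n) : EPFib z →ₗ[ℂ] NFib z :=
  TensorProduct.lift <| LinearMap.mk₂ ℂ (fun w φ => ⟨rankOne (w : V n) φ.1, rankOne_mem w φ⟩)
    (fun w w' φ => Subtype.ext <| ContinuousLinearMap.ext fun v => smul_add (φ.1 v) w.1 w'.1)
    (fun c w φ => Subtype.ext <| ContinuousLinearMap.ext fun v => smul_comm (φ.1 v) c w.1)
    (fun w φ φ' => Subtype.ext <| ContinuousLinearMap.ext fun v =>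
      add_smul (φ.1 v) (φ'.1 v) w.1)
    (fun c w φ => Subtype.ext <| ContinuousLinearMap.ext fun v => smul_assoc c (φ.1 v) w.1)

theorem ofTensor_tmul {z : Gr n} (w : EFib z) (φ : PFib z) :
    (ofTensor z (w ⊗ₜ[ℂ] φ) : gl n) = rankOne w φ := rfl

theorem trivEP_tmul (e : Split n) (z : Gr n) (h : z ∈ (grChart e).source) (w : EFib z)
    (φ : PFib z) (i j : Fin n) :
    trivEP e z h (w ⊗ₜ[ℂ] φ) (i, j) = trivE e z h w i * trivP e z h φ j := by
  change ((Pi.basisFun ℂ (Fin n)).tensorProduct (Pi.basisFun ℂ (Fin n))).repr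
    (trivE e z h w ⊗ₜ[ℂ] trivP e z h φ) (i, j) = _
  simp [mul_comm]

/-- On pure tensors both sides have the entries wᵢφⱼ, and pure tensors determine a linear map. It
makes `ofTensor` bijective and independent of the chart used in `toTensor`. -/
theorem entries_trivN_ofTensor (e : Split n) (z : Gr n) (h : z ∈ (grChart e).source)
    (t : EPFib z) : entries n (trivN e z h (ofTensor z t)) = trivEP e z h t := by
  have h1 : (entries n).toLinearMap ∘ₗ (trivN e z h).toLinearMap ∘ₗ ofTensor z =
      (trivEP e z h).toLinearMap := by
    refine TensorProduct.ext' fun w φ => ?_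
    ext ⟨i, j⟩
    change entries n (trivN e z h (ofTensor z (w ⊗ₜ[ℂ] φ))) (i, j) =
      trivEP e z h (w ⊗ₜ[ℂ] φ) (i, j)
    rw [entries_apply, trivEP_tmul]
    change (e (φ.1 (inr e (Pi.single j 1)) • w.1)).1 i = _
    rw [map_smul]
    exact mul_comm _ _
  exact DFunLike.congr_fun h1 t

/-- The isomorphism of `N_z` with `E_z ⊗ E_z^⊥`. -/
noncomputable def toTensor (z : Gr n) : NFib z ≃ₗ[ℂ] EPFib z :=
  ((trivN (splitAt z) z (mem_splitAt z)).trans (entries n)).trans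
    (trivEP (splitAt z) z (mem_splitAt z)).symm

theorem toTensor_ofTensor (z : Gr n) (t : EPFib z) : toTensor z (ofTensor z t) = t := by
  change (trivEP (splitAt z) z (mem_splitAt z)).symm
    (entries n (trivN (splitAt z) z (mem_splitAt z) (ofTensor z t))) = t
  rw [entries_trivN_ofTensor, LinearEquiv.symm_apply_apply]

theorem toTensor_symm_apply (z : Gr n) (t : EPFib z) : (toTensor z).symm t = ofTensor z t := by
  rw [LinearEquiv.symm_apply_eq, toTensor_ofTensor]

theorem ofTensor_toTensor (z : Gr n) (Z : NFib z) : ofTensor z (toTensor z Z) = Z := by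
  rw [← toTensor_symm_apply, LinearEquiv.symm_apply_apply]

theorem isVectorBundleIso_toTensor :
    IsVectorBundleIso (M n) (Fin n × Fin n → ℂ) (toTensor (n := n)) :=
  isVectorBundleIso_of_coordinates _ (entries n).toContinuousLinearEquiv fun z₀ z h Z => by
    rw [trivializationAt_EP h, trivializationAt_N h, ← entries_trivN_ofTensor, ofTensor_toTensor]
    rfl

/-! ### The chart attached to an idempotent -/

section Idempotent

variable {p : gl n} {e : Split n} {A : M n}

/-- The map `w ↦ (e (p w))₁`, which has the same kernel as `p` if `Im p` is a graph. -/
noncomputable def fstComp (e : Split n) (p : gl n) : V n →L[ℂ] K n :=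
  ContinuousLinearMap.fst ℂ (K n) (K n) ∘L (e : V n →L[ℂ] K n × K n) ∘L p

/-- The block of `p` which is invertible on the domain of the chart `φ_p`. -/
noncomputable def fstBlock (e : Split n) (p : gl n) (B : M n) : M n :=
  fstComp e p ∘L graphMap e B

theorem graphMap_fstComp (hr : LinearMap.range (p : V n →ₗ[ℂ] V n) = (graph e A).space)
    (w : V n) : graphMap e A (fstComp e p w) = p w := by
  have h := graphMap_fst (mem_source_graph e A) (w := p w) (hr ▸ ⟨w, rfl⟩)
  rwa [grChart_graph] at h

/-- An idempotent fixes its image, which here is the graph of A. -/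
theorem fstBlock_self (hp : p ∘L p = p)
    (hr : LinearMap.range (p : V n →ₗ[ℂ] V n) = (graph e A).space) :
    fstBlock e p A = ContinuousLinearMap.id ℂ (K n) := by
  ext1 k
  apply graphMap_injective e A
  change graphMap e A (fstComp e p (graphMap e A k)) = _
  rw [graphMap_fstComp hr]
  have h : graphMap e A k ∈ LinearMap.range (p : V n →ₗ[ℂ] V n) := hr ▸ ⟨k, rfl⟩
  obtain ⟨v, hv⟩ := h
  change p v = _ at hv
  change p (graphMap e A k) = graphMap e A k
  rw [← hv]
  exact DFunLike.congr_fun hp v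

theorem mem_ker_iff_fstComp (hr : LinearMap.range (p : V n →ₗ[ℂ] V n) = (graph e A).space)
    (w : V n) : w ∈ LinearMap.ker (p : V n →ₗ[ℂ] V n) ↔ fstComp e p w = 0 := by
  change p w = 0 ↔ _
  rw [← graphMap_fstComp hr w]
  exact ⟨fun h => graphMap_injective e A (by rw [h, map_zero]), fun h => by rw [h, map_zero]⟩

/-- The projection onto the graph of `B` along the kernel of `p`. -/
noncomputable def projGraph (e : Split n) (p : gl n) (B : M n) : gl n :=
  graphMap e B ∘L Ring.inverse (fstBlock e p B) ∘L fstComp e p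

/-- `fstComp e p` has kernel Ker p and is bijective on the graph of B when the block is invertible.
So the projection of w is the unique point of that graph with the same value of `fstComp e p` as w.
-/
theorem phi_graph (hr : LinearMap.range (p : V n →ₗ[ℂ] V n) = (graph e A).space) {B : M n}
    (hu : IsUnit (fstBlock e p B)) : phi p (graph e B) = projGraph e p B - p := by
  have h1 (k : K n) : Ring.inverse (fstBlock e p B) (fstComp e p (graphMap e B k)) =
      k := DFunLike.congr_fun (Ring.inverse_mul_cancel _ hu) k
  have h2 (k : K n) : fstComp e p (graphMap e B (Ring.inverse (fstBlock e p B) k)) =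
      k := DFunLike.congr_fun (Ring.mul_inverse_cancel _ hu) k
  have hq (w : V n) : w - projGraph e p B w ∈ LinearMap.ker (p : V n →ₗ[ℂ] V n) := by
    rw [mem_ker_iff_fstComp hr, map_sub, sub_eq_zero]
    exact (h2 _).symm
  have hc : IsCompl (graph e B).space (LinearMap.ker (p : V n →ₗ[ℂ] V n)) := by
    constructor
    · rw [Submodule.disjoint_def]
      rintro _ ⟨k, rfl⟩ hk
      rw [mem_ker_iff_fstComp hr] at hk
      have h3 := h1 k
      change fstComp e p (graphMap e B k) = 0 at hk
      rw [hk, map_zero] at h3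
      rw [← h3, map_zero]
    · rw [Submodule.codisjoint_iff_exists_add_eq]
      exact fun w => ⟨projGraph e p B w, w - projGraph e p B w, ⟨_, rfl⟩, hq w, by abel⟩
  rw [phi, dif_pos hc]
  congr 1
  ext1 w
  change Submodule.projection _ _ hc w = _
  have h3 : w = projGraph e p B w + (w - projGraph e p B w) := by abel
  conv_lhs => rw [h3]
  rw [map_add, Submodule.projection_apply_of_mem_left hc (x := projGraph e p B w) ⟨_, rfl⟩,
    (Submodule.projection_apply_eq_zero_iff hc).2 (hq w), add_zero]

theorem isUnit_fstComp (hp : p ∘L p = p)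
    (hr : LinearMap.range (p : V n →ₗ[ℂ] V n) = (graph e A).space) :
    IsUnit (fstBlock e p A) := by
  rw [fstBlock_self hp hr]
  exact isUnit_one

theorem contDiff_fstBlock (e : Split n) (p : gl n) :
    ContDiff ℂ ω (fstBlock e p) := by
  unfold fstBlock
  have := contDiff_graphMap e
  fun_prop

theorem eventually_phi_graph (hp : p ∘L p = p)
    (hr : LinearMap.range (p : V n →ₗ[ℂ] V n) = (graph e A).space) :
    ∀ᶠ B in 𝓝 A, phi p (graph e B) = projGraph e p B - p := by
  filter_upwards [(contDiff_fstBlock e p).continuous.continuousAt.eventually_mem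
    (Units.isOpen.mem_nhds (isUnit_fstComp hp hr))] with B hB
  exact phi_graph hr hB

theorem phi_graph_self (hp : p ∘L p = p)
    (hr : LinearMap.range (p : V n →ₗ[ℂ] V n) = (graph e A).space) : phi p (graph e A) = 0 := by
  rw [phi_graph hr (isUnit_fstComp hp hr), projGraph, fstBlock_self hp hr, sub_eq_zero]
  ext1 w
  change graphMap e A (Ring.inverse (1 : M n) (fstComp e p w)) = p w
  rw [Ring.inverse_one]
  exact graphMap_fstComp hr w

theorem differentiableAt_phi_graph (hp : p ∘L p = p)
    (hr : LinearMap.range (p : V n →ₗ[ℂ] V n) = (graph e A).space) :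
    DifferentiableAt ℂ (fun B => phi p (graph e B)) A := by
  obtain ⟨u, hu⟩ := isUnit_fstComp hp hr
  have h1 : ContDiffAt ℂ ω Ring.inverse (fstBlock e p A) :=
    hu ▸ contDiffAt_ringInverse ℂ u
  have h2 : ContDiffAt ℂ ω (fun B => Ring.inverse (fstBlock e p B)) A :=
    h1.comp A (contDiff_fstBlock e p).contDiffAt
  have h3 : ContDiffAt ℂ ω (fun B => projGraph e p B - p) A :=
    ((contDiff_graphMap e).contDiffAt.clm_comp (h2.clm_comp contDiffAt_const)).sub
      contDiffAt_const
  exact (h3.congr_of_eventuallyEq (eventually_phi_graph hp hr)).differentiableAt (by simp)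

/-- Modulo z, the derivative of φ_p in direction X is X applied to the coordinate of pw. This comes
from differentiating the graph equation of q w, where q projects onto the graph of A + tX along Ker
p. -/
theorem coker_comp_fderiv_phi (hp : p ∘L p = p)
    (hr : LinearMap.range (p : V n →ₗ[ℂ] V n) = (graph e A).space) (X : M n) :
    coker e A ∘L fderiv ℂ (fun B => phi p (graph e B)) A X = X ∘L fstComp e p := by
  ext1 w
  have h1 : HasDerivAt (fun t : ℂ => phi p (graph e (A + t • X)))
      (fderiv ℂ (fun B => phi p (graph e B)) A X) 0 :=
    (differentiableAt_phi_graph hp hr).hasFDerivAt.comp_hasDerivAt_of_eq 0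
      (hasDerivAt_add_smul A X) (by simp)
  -- Adding pw turns φ_p back into the projection, whose values lie on the moving graph.
  have h2 : HasDerivAt (fun t : ℂ => phi p (graph e (A + t • X)) w + p w)
      (fderiv ℂ (fun B => phi p (graph e B)) A X w) 0 := by
    simpa using (h1.clm_apply (hasDerivAt_const 0 w)).add_const (p w)
  have h3 := (e : V n →L[ℂ] K n × K n).hasFDerivAt.comp_hasDerivAt 0 h2
  have h4 := (ContinuousLinearMap.fst ℂ (K n) (K n)).hasFDerivAt.comp_hasDerivAt 0 h3
  have h5 := (ContinuousLinearMap.snd ℂ (K n) (K n)).hasFDerivAt.comp_hasDerivAt 0 h3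
  have h6 := (hasDerivAt_add_smul A X).clm_apply h4
  have h7 := h5.unique (h6.congr_of_eventuallyEq (by
    filter_upwards [eventually_line X (eventually_phi_graph hp hr)] with t ht
    change (e (phi p (graph e (A + t • X)) w + p w)).2 =
      (A + t • X) (e (phi p (graph e (A + t • X)) w + p w)).1
    rw [ht, ← mem_graph (e := e) (A := A + t • X)]
    change projGraph e p (A + t • X) w - p w + p w ∈ _
    rw [sub_add_cancel]
    exact ⟨_, rfl⟩))
  change (e (fderiv ℂ (fun B => phi p (graph e B)) A X w)).2 =
    X (e (phi p (graph e (A + (0 : ℂ) • X)) w + p w)).1 + (A + (0 : ℂ) • X)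
      (e (fderiv ℂ (fun B => phi p (graph e B)) A X w)).1 at h7
  rw [zero_smul, add_zero, phi_graph_self hp hr, zero_apply, zero_add] at h7
  change coker e A (fderiv ℂ (fun B => phi p (graph e B)) A X w) = X (e (p w)).1
  rw [coker_apply, h7, add_sub_cancel_right]

/-- The factorization ℂ²ⁿ → ℂ²ⁿ/z → z → ℂ²ⁿ of Z, read in coordinates. -/
theorem coe_eq_graphMap_comp_trivN (Z : NFib (graph e A)) :
    (Z : gl n) = graphMap e A ∘L trivN e _ (mem_source_graph e A) Z ∘L coker e A := by
  have h2 := congrArg Subtype.val ((trivN e _ (mem_source_graph e A)).symm_apply_apply Z)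
  change graphMap e (grChart e (graph e A)) ∘L _ ∘L coker e (grChart e (graph e A)) = _ at h2
  rw [grChart_graph] at h2
  exact h2.symm

theorem traceForm_fderiv_phi (hp : p ∘L p = p)
    (hr : LinearMap.range (p : V n →ₗ[ℂ] V n) = (graph e A).space) (Z : NFib (graph e A))
    (X : M n) :
    traceForm Z (fderiv ℂ (fun B => phi p (graph e B)) A X) =
      tr n (trivN e _ (mem_source_graph e A) Z ∘L X) := by
  have h1 := coe_eq_graphMap_comp_trivN Z
  set Y := trivN e _ (mem_source_graph e A) Z
  rw [traceForm, h1, ContinuousLinearMap.comp_assoc, ContinuousLinearMap.comp_assoc,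
    coker_comp_fderiv_phi hp hr]
  -- Cyclicity of the trace between ℂⁿ and ℂ²ⁿ moves `graphMap` to the right end, where it meets
  -- `fstComp` and gives the identity.
  change LinearMap.trace ℂ (V n) ((graphMap e A : K n →ₗ[ℂ] V n) ∘ₗ
    ((Y ∘L X ∘L fstComp e p : V n →L[ℂ] K n) : V n →ₗ[ℂ] K n)) = _
  rw [LinearMap.trace_comp_comm']
  change tr n (Y ∘L X ∘L fstBlock e p A) = _
  rw [fstBlock_self hp hr, ContinuousLinearMap.comp_id]

end Idempotent

theorem mdifferentiableAt_phi {p : gl n} {z : Gr n} (hp : p ∘L p = p)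
    (hr : LinearMap.range (p : V n →ₗ[ℂ] V n) = z.space) :
    MDifferentiableAt 𝓘(ℂ, M n) 𝓘(ℂ, gl n) (phi p) z := by
  have hz := mem_splitAt z
  have h1 : MDifferentiableAt 𝓘(ℂ, M n) 𝓘(ℂ, gl n)
      (fun B => phi p (graph (splitAt z) B)) (grChart (splitAt z) z) :=
    (differentiableAt_phi_graph hp (by rw [hr, graph_grChart hz])).mdifferentiableAt
  have h2 : MDifferentiableAt 𝓘(ℂ, M n) 𝓘(ℂ, M n) (grChart (splitAt z)) z :=
    ((contMDiffOn_grChart (splitAt z)).contMDiffAt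
      ((isOpen_source _).mem_nhds hz)).mdifferentiableAt (by simp)
  refine (h1.comp z h2).congr_of_eventuallyEq ?_
  filter_upwards [(isOpen_source (splitAt z)).mem_nhds hz] with y hy
  exact congrArg (phi p) (graph_grChart hy).symm

theorem mfderiv_phi {p : gl n} {z : Gr n} (hp : p ∘L p = p)
    (hr : LinearMap.range (p : V n →ₗ[ℂ] V n) = z.space) :
    mfderiv 𝓘(ℂ, M n) 𝓘(ℂ, gl n) (phi p) z =
      fderiv ℂ (fun B => phi p (graph (splitAt z) B)) (grChart (splitAt z) z) := by
  rw [(mdifferentiableAt_phi hp hr).mfderiv]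
  change fderivWithin ℂ (fun B => phi p (graph (splitAt z) B)) (range id)
    (grChart (splitAt z) z) = _
  rw [range_id, fderivWithin_univ]

theorem toCot_eq_traceForm {p : gl n} {z : Gr n} (Z : NFib z) (hp : p ∘L p = p)
    (hr : LinearMap.range (p : V n →ₗ[ℂ] V n) = z.space) (X : TangentSpace 𝓘(ℂ, M n) z) :
    toCot z Z X = traceForm Z (mfderiv 𝓘(ℂ, M n) 𝓘(ℂ, gl n) (phi p) z X) := by
  rw [mfderiv_phi hp hr]
  -- The splitting is freed from z, since z cannot be replaced by a graph while `splitAt z` depends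
  -- on it.
  have key (e : Split n) (h : z ∈ (grChart e).source) (Y : M n) :
      tr n (trivN e z h Z ∘L Y) =
        traceForm Z (fderiv ℂ (fun B => phi p (graph e B)) (grChart e z) Y) := by
    obtain ⟨A, rfl⟩ := h
    rw [grChart_graph]
    exact (traceForm_fderiv_phi hp hr Z Y).symm
  exact key _ (mem_splitAt z) X

/-! ### Transport of actions and orbits along isomorphisms -/

section Transport

variable {F F' : Type} {E E' : Gr n → Type}
  [∀ z, AddCommGroup (E z)] [∀ z, Module ℂ (E z)]
  [∀ z, AddCommGroup (E' z)] [∀ z, Module ℂ (E' z)]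
  {ρ : ∀ (g : GL2 n) (z : Gr n), E z →ₗ[ℂ] E (g • z)}
  {ρ' : ∀ (g : GL2 n) (z : Gr n), E' z →ₗ[ℂ] E' (g • z)} {f : ∀ z, E z ≃ₗ[ℂ] E' z}

theorem totalMap_totalAct (h : ∀ g z v, f (g • z) (ρ g z v) = ρ' g z (f z v)) (g : GL2 n)
    (x : TotalSpace F E) :
    totalMap F F' f (totalAct F ρ g x) = totalAct F' ρ' g (totalMap F F' f x) :=
  congrArg (TotalSpace.mk (g • x.1)) (h g x.1 x.2)

theorem totalMap_symm_totalMap (x : TotalSpace F E) :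
    totalMap F' F (fun z => (f z).symm) (totalMap F F' f x) = x :=
  congrArg (TotalSpace.mk x.1) ((f x.1).symm_apply_apply x.2)

theorem totalMap_totalMap_symm (x : TotalSpace F' E') :
    totalMap F F' f (totalMap F' F (fun z => (f z).symm) x) = x :=
  congrArg (TotalSpace.mk x.1) ((f x.1).apply_symm_apply x.2)

theorem totalMap_injective : Function.Injective (totalMap F F' f) :=
  Function.LeftInverse.injective totalMap_symm_totalMap

theorem SplitsIntoOrbits.image {S : ℕ → Set (TotalSpace F E)} (hS : SplitsIntoOrbits ρ S)
    (h : ∀ g z v, f (g • z) (ρ g z v) = ρ' g z (f z v)) :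
    SplitsIntoOrbits ρ' (fun k => totalMap F F' f '' S k) := by
  constructor
  · intro y
    obtain ⟨x, rfl⟩ : ∃ x, totalMap F F' f x = y := ⟨_, totalMap_totalMap_symm y⟩
    simpa only [totalMap_injective.mem_set_image] using hS.1 x
  · intro k hk
    obtain ⟨x, hx⟩ := hS.2 k hk
    refine ⟨totalMap F F' f x, ?_⟩
    change totalMap F F' f '' S k = _
    rw [hx, orbit, orbit, ← range_comp]
    exact congrArg range (funext fun g => totalMap_totalAct h g x)

variable [∀ z, TopologicalSpace (E z)] [∀ z, TopologicalSpace (E' z)]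
  [NormedAddCommGroup F] [NormedSpace ℂ F]
  [TopologicalSpace (TotalSpace F E)] [FiberBundle F E] [VectorBundle ℂ F E]
  [NormedAddCommGroup F'] [NormedSpace ℂ F']
  [TopologicalSpace (TotalSpace F' E')] [FiberBundle F' E'] [VectorBundle ℂ F' E']

/-- ρ' g is the conjugate of ρ g by the biholomorphic map f. Thus the actions on the tensor product
and on the cotangent bundle need no separate verification. -/
theorem IsVectorBundleAction.transport (hρ : IsVectorBundleAction F ρ)
    (hf : IsVectorBundleIso F F' f) (h : ∀ g z v, f (g • z) (ρ g z v) = ρ' g z (f z v)) :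
    IsVectorBundleAction F' ρ' := by
  have key (g : GL2 n) (y : TotalSpace F' E') : totalAct F' ρ' g y =
      totalMap F F' f (totalAct F ρ g (totalMap F' F (fun z => (f z).symm) y)) := by
    rw [totalMap_totalAct h, totalMap_totalMap_symm]
  refine ⟨fun y => ?_, fun g g' y => ?_, fun g => ?_⟩
  · rw [key, hρ.one, totalMap_totalMap_symm]
  · rw [key, key, key g', hρ.mul, totalMap_symm_totalMap]
  · rw [show totalAct F' ρ' g = _ from funext (key g)]
    exact hf.holomorphic.comp ((hρ.holomorphic g).comp hf.holomorphic_symm)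

theorem IsVectorBundleIso.symm (hf : IsVectorBundleIso F F' f) :
    IsVectorBundleIso F' F (fun z => (f z).symm) :=
  ⟨hf.holomorphic_symm, hf.holomorphic⟩

variable {F'' : Type} {E'' : Gr n → Type}
  [∀ z, AddCommGroup (E'' z)] [∀ z, Module ℂ (E'' z)] [∀ z, TopologicalSpace (E'' z)]
  [NormedAddCommGroup F''] [NormedSpace ℂ F'']
  [TopologicalSpace (TotalSpace F'' E'')] [FiberBundle F'' E''] [VectorBundle ℂ F'' E'']

theorem IsVectorBundleIso.trans {f' : ∀ z, E' z ≃ₗ[ℂ] E'' z} (hf : IsVectorBundleIso F F' f)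
    (hf' : IsVectorBundleIso F' F'' f') :
    IsVectorBundleIso F F'' (fun z => (f z).trans (f' z)) :=
  ⟨hf'.holomorphic.comp hf.holomorphic, hf.holomorphic_symm.comp hf'.holomorphic_symm⟩

end Transport

/-! ### The action on the Grassmannian in charts -/

theorem mem_smul_iff {g : GL2 n} {z : Gr n} {w : V n} : w ∈ (g • z).space ↔ g.symm w ∈ z.space :=
  ⟨inv_mem_of_mem_smul g, fun h => by simpa using mem_smul_of_mem g h⟩

/-- The action is the identity in coordinates, between the charts of e and of e ∘ g⁻¹. All
computations with σ_g thereby become changes of chart. -/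
theorem smul_graph (g : GL2 n) (e : Split n) (A : M n) :
    g • graph e A = graph (g.symm.trans e) A := by
  ext w
  rw [mem_smul_iff, mem_graph, mem_graph]
  rfl

theorem smul_mem_source {e : Split n} {z : Gr n} (g : GL2 n) (h : z ∈ (grChart e).source) :
    g • z ∈ (grChart (g.symm.trans e)).source := by
  obtain ⟨A, rfl⟩ := h
  exact ⟨A, (smul_graph g e A).symm⟩

theorem grChart_smul {e : Split n} {z : Gr n} (g : GL2 n) (h : z ∈ (grChart e).source) :
    grChart (g.symm.trans e) (g • z) = grChart e z := by
  obtain ⟨A, rfl⟩ := h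
  rw [smul_graph, grChart_graph, grChart_graph]

theorem contMDiff_smul (g : GL2 n) :
    ContMDiff 𝓘(ℂ, M n) 𝓘(ℂ, M n) ω (fun z : Gr n => g • z) := by
  intro z
  have hz := mem_splitAt z
  have h1 := (contMDiff_graph (g.symm.trans (splitAt z))).contMDiffAt.comp z
    ((contMDiffOn_grChart (splitAt z)).contMDiffAt ((isOpen_source _).mem_nhds hz))
  refine h1.congr_of_eventuallyEq ?_
  filter_upwards [(isOpen_source (splitAt z)).mem_nhds hz] with y hy
  change g • y = graph _ (grChart (splitAt z) y)
  rw [← smul_graph, graph_grChart hy]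

theorem mfderiv_smul (g : GL2 n) (z : Gr n) :
    mfderiv 𝓘(ℂ, M n) 𝓘(ℂ, M n) (fun z : Gr n => g • z) z =
      fderiv ℂ (transition (g.symm.trans (splitAt z)) (splitAt (g • z)))
        (grChart (splitAt z) z) := by
  rw [((contMDiff_smul g).contMDiffAt.mdifferentiableAt (by simp)).mfderiv]
  have h : transition (g.symm.trans (splitAt z)) (splitAt (g • z)) =
      fun A => grChart (splitAt (g • z)) (g • graph (splitAt z) A) := by
    funext A
    rw [transition, smul_graph]
  rw [h]
  change fderivWithin ℂ (fun A => grChart (splitAt (g • z)) (g • graph (splitAt z) A)) (range id)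
    (grChart (splitAt z) z) = _
  rw [range_id, fderivWithin_univ]

theorem trivN_actN (g : GL2 n) {e : Split n} {z : Gr n} (h : z ∈ (grChart e).source)
    (Z : NFib z) :
    trivN (g.symm.trans e) (g • z) (smul_mem_source g h) (actN g z Z) = trivN e z h Z := by
  ext1 y
  change (e (g.symm (g (Z.1 (g.symm (g (e.symm (0, y)))))))).1 = (e (Z.1 (e.symm (0, y)))).1
  simp

/-! ### The action on the bundle of nilpotent elements -/

/-- Fibres over equal points such as (gh)z and g(hz) are different types; comparing the underlying
endomorphisms of ℂ²ⁿ avoids transport between them. -/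
theorem totalSpace_N_ext {x y : TotalSpace (M n) (NFib (n := n))} (h : x.1 = y.1)
    (h' : (x.2 : gl n) = y.2) : x = y := by
  obtain ⟨z, Z⟩ := x
  obtain ⟨z', Z'⟩ := y
  obtain rfl : z = z' := h
  obtain rfl : Z = Z' := Subtype.ext h'
  rfl

/-- In fibre coordinates the action is the bundle transition from the transported chart e ∘ g⁻¹ to
the chart at the image point, and this depends analytically on the base coordinate. -/
theorem contMDiff_totalAct_N (g : GL2 n) :
    ContMDiff (𝓘(ℂ, M n).prod 𝓘(ℂ, M n)) (𝓘(ℂ, M n).prod 𝓘(ℂ, M n)) ω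
      (totalAct (M n) (actN (n := n)) g) := by
  intro x
  have hproj : ContMDiffAt (𝓘(ℂ, M n).prod 𝓘(ℂ, M n)) 𝓘(ℂ, M n) ω
      (fun y : TotalSpace (M n) (NFib (n := n)) => y.1) x := contMDiffAt_proj _
  refine contMDiffAt_totalSpace.2 ⟨(contMDiff_smul g).contMDiffAt.comp x hproj, ?_⟩
  set e := splitAt x.1
  set e' := splitAt (g • x.1)
  have h1 : ContMDiffAt (𝓘(ℂ, M n).prod 𝓘(ℂ, M n)) 𝓘(ℂ, M n →L[ℂ] M n) ω
      (fun y : TotalSpace (M n) (NFib (n := n)) =>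
        (framesN n).change (g.symm.trans e) e' (grChart e y.1)) x :=
    (((framesN n).contDiff_change _ _).contMDiff.contMDiffAt.comp x.1
      ((contMDiffOn_grChart e).contMDiffAt
        ((isOpen_source _).mem_nhds (mem_splitAt x.1)))).comp x hproj
  refine (h1.clm_apply (contMDiffAt_coordinate x)).congr_of_eventuallyEq ?_
  have h2 := ((contMDiff_smul g).contMDiffAt.comp x hproj).continuousAt.eventually_mem
    ((isOpen_source e').mem_nhds (mem_splitAt (g • x.1)))
  filter_upwards [eventually_proj_mem_source x, h2] with y hy hy'
  have h3 := trivializationAt_N (z₀ := g • x.1) (z := g • y.1) hy' (actN g y.1 y.2)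
  refine h3.trans ?_
  rw [trivN_change (smul_mem_source g hy) hy', trivN_actN g hy, grChart_smul g hy]
  change _ = (framesN n).change (g.symm.trans e) e' (grChart e y.1)
    (trivializationAt (M n) (NFib (n := n)) x.1 ⟨y.1, y.2⟩).2
  rw [trivializationAt_N hy]
  rfl

theorem isVectorBundleAction_actN : IsVectorBundleAction (M n) (actN (n := n)) where
  one x := totalSpace_N_ext (one_smul (GL2 n) x.1) rfl
  mul g h x := totalSpace_N_ext (mul_smul g h x.1) rfl
  holomorphic := contMDiff_totalAct_N

/-! ### Equivariance -/

theorem ofTensor_actEP (g : GL2 n) (z : Gr n) (t : EPFib z) :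
    ofTensor (g • z) (actEP g z t) = actN g z (ofTensor z t) := by
  have h : ofTensor (g • z) ∘ₗ actEP g z = actN g z ∘ₗ ofTensor z := by
    refine TensorProduct.ext' fun w φ => Subtype.ext (ContinuousLinearMap.ext fun v => ?_)
    exact (map_smul g (φ.1 (g.symm v)) w.1).symm
  exact DFunLike.congr_fun h t

theorem toTensor_actN (g : GL2 n) (z : Gr n) (Z : NFib z) :
    toTensor (g • z) (actN g z Z) = actEP g z (toTensor z Z) := by
  rw [← LinearEquiv.eq_symm_apply, toTensor_symm_apply, ofTensor_actEP, ofTensor_toTensor]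

/-- dσ_g is the derivative of a transition out of the transported chart, in which gZg⁻¹ has the
matrix of Z. Invariance under g is thus a case of chart independence. -/
theorem toCot_actN_mfderiv (g : GL2 n) (z : Gr n) (Z : NFib z) (X : TangentSpace 𝓘(ℂ, M n) z) :
    toCot (g • z) (actN g z Z) (mfderiv 𝓘(ℂ, M n) 𝓘(ℂ, M n) (fun z : Gr n => g • z) z X) =
      toCot z Z X := by
  rw [mfderiv_smul]
  have h := tr_trivN_comp_fderiv_transition (smul_mem_source g (mem_splitAt z))
    (mem_splitAt (g • z)) (actN g z Z) X
  rw [grChart_smul g (mem_splitAt z), trivN_actN g (mem_splitAt z)] at h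
  exact h

theorem isInvertible_mfderiv_smul (g : GL2 n) (z : Gr n) :
    (mfderiv 𝓘(ℂ, M n) 𝓘(ℂ, M n) (fun z : Gr n => g • z) z).IsInvertible := by
  rw [mfderiv_smul]
  have h : Function.Injective (fderiv ℂ (transition (g.symm.trans (splitAt z))
      (splitAt (g • z))) (grChart (splitAt z) z)) := by
    apply injective_fderiv_transition
    rw [← smul_graph, graph_grChart (mem_splitAt z)]
    exact mem_splitAt (g • z)
  exact ⟨(LinearEquiv.ofInjectiveEndo (_ : M n →ₗ[ℂ] M n) h).toContinuousLinearEquiv, rfl⟩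

theorem toCot_actN (g : GL2 n) (z : Gr n) (Z : NFib z) :
    toCot (g • z) (actN g z Z) = actCot g z (toCot z Z) := by
  -- `inverse` would be 0 on a map that is not invertible, so the invertibility of dσ_g is needed
  -- here.
  have h1 (X : TangentSpace 𝓘(ℂ, M n) (g • z)) :
      mfderiv 𝓘(ℂ, M n) 𝓘(ℂ, M n) (fun z : Gr n => g • z) z
        ((mfderiv 𝓘(ℂ, M n) 𝓘(ℂ, M n) (fun z : Gr n => g • z) z).inverse X) = X :=
    (isInvertible_mfderiv_smul g z).self_apply_inverse X
  refine ContinuousLinearMap.ext fun X => ?_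
  have h2 := toCot_actN_mfderiv g z Z
    ((mfderiv 𝓘(ℂ, M n) 𝓘(ℂ, M n) (fun z : Gr n => g • z) z).inverse X)
  rw [h1] at h2
  exact h2

/-! ### Orbits -/

/-- Two endomorphisms of a finite dimensional space which have the same rank are equivalent. -/
theorem exists_equiv_of_finrank_range_eq {k E : Type*} [Field k] [AddCommGroup E] [Module k E]
    [FiniteDimensional k E] (f f' : E →ₗ[k] E)
    (h : Module.finrank k (LinearMap.range f) = Module.finrank k (LinearMap.range f')) :
    ∃ P Q : E ≃ₗ[k] E, ∀ y, P (f y) = f' (Q y) := by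
  obtain ⟨C, hC⟩ := (LinearMap.ker f).exists_isCompl
  obtain ⟨C', hC'⟩ := (LinearMap.ker f').exists_isCompl
  obtain ⟨D, hD⟩ := (LinearMap.range f).exists_isCompl
  obtain ⟨D', hD'⟩ := (LinearMap.range f').exists_isCompl
  have h1 := f.finrank_range_add_finrank_ker
  have h2 := f'.finrank_range_add_finrank_ker
  have h3 := Submodule.finrank_add_eq_of_isCompl hD
  have h4 := Submodule.finrank_add_eq_of_isCompl hD'
  let a : LinearMap.range f ≃ₗ[k] LinearMap.range f' := LinearEquiv.ofFinrankEq _ _ h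
  let b : D ≃ₗ[k] D' := LinearEquiv.ofFinrankEq _ _ (by omega)
  let c : LinearMap.ker f ≃ₗ[k] LinearMap.ker f' := LinearEquiv.ofFinrankEq _ _ (by omega)
  -- The restriction of f to a complement of its kernel, an isomorphism onto the image.
  let r : C ≃ₗ[k] LinearMap.range f :=
    (Submodule.quotientEquivOfIsCompl _ _ hC).symm.trans f.quotKerEquivRange
  let r' : C' ≃ₗ[k] LinearMap.range f' :=
    (Submodule.quotientEquivOfIsCompl _ _ hC').symm.trans f'.quotKerEquivRange
  have hr (x : C) : (r x : E) = f x := by simp [r]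
  have hr' (x : C') : (r' x : E) = f' x := by simp [r']
  -- P is a ⊕ b on Im f ⊕ D, and Q is c ⊕ r'⁻¹ar on Ker f ⊕ C; the second summand of Q is forced by
  -- P f = f' Q.
  refine ⟨((Submodule.prodEquivOfIsCompl _ _ hD).symm.trans (a.prodCongr b)).trans
    (Submodule.prodEquivOfIsCompl _ _ hD'),
    ((Submodule.prodEquivOfIsCompl _ _ hC).symm.trans
      (c.prodCongr ((r.trans a).trans r'.symm))).trans
    (Submodule.prodEquivOfIsCompl _ _ hC'), fun y => ?_⟩
  obtain ⟨⟨u, v⟩, rfl⟩ := (Submodule.prodEquivOfIsCompl _ _ hC).surjective y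
  have h5 : f (Submodule.prodEquivOfIsCompl _ _ hC (u, v)) = r v := by
    rw [hr, Submodule.coe_prodEquivOfIsCompl', map_add, LinearMap.mem_ker.1 u.2, zero_add]
  have h6 (s : LinearMap.range f') : f' (r'.symm s) = s := by
    rw [← hr', LinearEquiv.apply_symm_apply]
  have h7 : f' (c u) = 0 := (c u).2
  rw [h5]
  simp [h6, h7]

theorem exists_submodule_finrank_eq {k E : Type*} [Field k] [AddCommGroup E] [Module k E]
    [FiniteDimensional k E] {m : ℕ} (h : m ≤ Module.finrank k E) :
    ∃ W : Submodule k E, Module.finrank k W = m := by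
  obtain ⟨s, hs, hli⟩ := exists_finset_linearIndependent_of_le_finrank h
  exact ⟨Submodule.span k s, by rw [finrank_span_finset_eq_card hli, hs]⟩

/-- Z is Y preceded by a surjection and followed by an injection. -/
theorem finrank_range_trivN {e : Split n} {A : M n} (Z : NFib (graph e A)) :
    Module.finrank ℂ (LinearMap.range (trivN e _ (mem_source_graph e A) Z : K n →ₗ[ℂ] K n)) =
      Module.finrank ℂ (LinearMap.range ((Z : gl n) : V n →ₗ[ℂ] V n)) := by
  have h1 := coe_eq_graphMap_comp_trivN Z
  set Y := trivN e _ (mem_source_graph e A) Z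
  rw [h1]
  change _ = Module.finrank ℂ (LinearMap.range ((graphMap e A : K n →ₗ[ℂ] V n) ∘ₗ
    (Y : K n →ₗ[ℂ] K n) ∘ₗ (coker e A : V n →ₗ[ℂ] K n)))
  have h2 : LinearMap.range (coker e A : V n →ₗ[ℂ] K n) = ⊤ :=
    LinearMap.range_eq_top.2 fun y => ⟨inr e y, coker_inr e A y⟩
  rw [LinearMap.range_comp, LinearMap.range_comp_of_range_eq_top _ h2]
  exact (Submodule.equivMapOfInjective _ (graphMap_injective e A) _).finrank_eq

theorem finrank_range_actN (g : GL2 n) (z : Gr n) (Z : NFib z) :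
    Module.finrank ℂ (LinearMap.range ((actN g z Z : gl n) : V n →ₗ[ℂ] V n)) =
      Module.finrank ℂ (LinearMap.range ((Z : gl n) : V n →ₗ[ℂ] V n)) := by
  change Module.finrank ℂ (LinearMap.range ((g.toLinearEquiv : V n →ₗ[ℂ] V n) ∘ₗ
    ((Z : gl n) : V n →ₗ[ℂ] V n) ∘ₗ (g.symm.toLinearEquiv : V n →ₗ[ℂ] V n))) = _
  rw [LinearMap.range_comp, LinearMap.range_comp_of_range_eq_top _ (LinearEquiv.range _),
    LinearEquiv.finrank_map_eq]

theorem apply_coe_of_graph_zero {e : Split n} (Z : NFib (graph e 0)) (v : V n) :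
    e ((Z : gl n) v) = (trivN e _ (mem_source_graph e 0) Z (e v).2, 0) := by
  conv_lhs => rw [coe_eq_graphMap_comp_trivN Z]
  change e (graphMap e 0 (trivN e _ (mem_source_graph e 0) Z (coker e 0 v))) = _
  rw [graphMap_apply, coker_apply]
  simp

theorem exists_totalAct_eq (x x' : TotalSpace (M n) (NFib (n := n)))
    (h : Module.finrank ℂ (LinearMap.range ((x.2 : gl n) : V n →ₗ[ℂ] V n)) =
      Module.finrank ℂ (LinearMap.range ((x'.2 : gl n) : V n →ₗ[ℂ] V n))) :
    ∃ g, totalAct (M n) (actN (n := n)) g x = x' := by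
  obtain ⟨z, Z⟩ := x
  obtain ⟨z', Z'⟩ := x'
  obtain ⟨e, rfl⟩ := exists_split z
  obtain ⟨e', rfl⟩ := exists_split z'
  obtain ⟨P, Q, hPQ⟩ := exists_equiv_of_finrank_range_eq
    (trivN e _ (mem_source_graph e 0) Z : K n →ₗ[ℂ] K n)
    (trivN e' _ (mem_source_graph e' 0) Z' : K n →ₗ[ℂ] K n)
    (by rw [finrank_range_trivN, finrank_range_trivN]; exact h)
  -- Block diagonal in the two splittings: it maps the first summand z to z', and PY = Y'Q becomes
  -- gZ = Z'g.
  let g : GL2 n := (e.trans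
    (P.toContinuousLinearEquiv.prodCongr Q.toContinuousLinearEquiv)).trans e'.symm
  have hg (v : V n) : e' (g v) = (P (e v).1, Q (e v).2) := e'.apply_symm_apply _
  refine ⟨g, totalSpace_N_ext ?_ ?_⟩
  · ext w
    change w ∈ (g • graph e 0).space ↔ w ∈ (graph e' 0).space
    obtain ⟨v, rfl⟩ := g.surjective w
    rw [mem_smul_iff, mem_graph, mem_graph, hg]
    simp
  · ext1 w
    obtain ⟨v, rfl⟩ := g.surjective w
    apply e'.injective
    change e' (g ((Z : gl n) (g.symm (g v)))) = e' ((Z' : gl n) (g v))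
    rw [g.symm_apply_apply, hg, apply_coe_of_graph_zero, apply_coe_of_graph_zero, hg]
    exact Prod.ext (hPQ _) (map_zero Q)

theorem exists_mem_NOrbit {k : ℕ} (hk : k ≤ n) : ∃ x, x ∈ NOrbit n k := by
  obtain ⟨e⟩ : Nonempty (Split n) :=
    FiniteDimensional.nonempty_continuousLinearEquiv_of_finrank_eq (by simp; omega)
  obtain ⟨W, hW⟩ := exists_submodule_finrank_eq (k := ℂ) (E := K n) (m := k) (by simpa using hk)
  obtain ⟨W', hW'⟩ := W.exists_isCompl
  -- A projection of ℂⁿ onto a k-dimensional subspace serves as the block of rank k.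
  let Y : M n := LinearMap.toContinuousLinearMap (W.projection W' hW')
  refine ⟨⟨graph e 0, (trivN e _ (mem_source_graph e 0)).symm Y⟩, ?_⟩
  change Module.finrank ℂ (LinearMap.range (((trivN e _ (mem_source_graph e 0)).symm Y : gl n) :
    V n →ₗ[ℂ] V n)) = k
  rw [← finrank_range_trivN, LinearEquiv.apply_symm_apply]
  change Module.finrank ℂ (LinearMap.range (W.projection W' hW')) = k
  rw [Submodule.range_projection, hW]

theorem splitsIntoOrbits_NOrbit : SplitsIntoOrbits actN (NOrbit n) := by
  constructor
  · rintro ⟨z, Z⟩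
    refine ⟨_, ⟨?_, rfl⟩, fun k hk => hk.2.symm⟩
    -- The rank is at most n because Im Z lies in z.
    exact (Submodule.finrank_mono Z.2.1).trans_eq z.finrank_eq
  · intro k hk
    obtain ⟨x, hx⟩ := exists_mem_NOrbit hk
    refine ⟨x, ?_⟩
    ext y
    constructor
    · exact fun hy => exists_totalAct_eq x y (Eq.trans hx (Eq.symm hy))
    · rintro ⟨g, rfl⟩
      exact (finrank_range_actN g x.1 x.2).trans hx

end GrBundles

/-! ### Assembly of the isomorphisms, actions and orbits -/

theorem proposition2p3 (n : ℕ) :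
    ∃ (Φ : ∀ z : Gr n, NFib z ≃ₗ[ℂ] EPFib z) (Ψ : ∀ z : Gr n, EPFib z ≃ₗ[ℂ] CotFib z),
      (IsVectorBundleIso (M n) (Fin n × Fin n → ℂ) Φ ∧
        IsVectorBundleIso (Fin n × Fin n → ℂ) (M n →L[ℂ] ℂ) Ψ ∧
        (∀ (z : Gr n) (w : EFib z) (φ : PFib z),
          ((Φ z).symm (w ⊗ₜ[ℂ] φ) : gl n) = rankOne w φ) ∧
        (∀ (z : Gr n) (Z : NFib z) (p : gl n), p ∘L p = p →
          LinearMap.range (p : V n →ₗ[ℂ] V n) = z.space →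
          ∀ X : TangentSpace 𝓘(ℂ, M n) z,
            Ψ z (Φ z Z) X = traceForm Z (mfderiv 𝓘(ℂ, M n) 𝓘(ℂ, gl n) (phi p) z X))) ∧
      (IsVectorBundleAction (M n) (actN (n := n)) ∧
        IsVectorBundleAction (Fin n × Fin n → ℂ) (actEP (n := n)) ∧
        IsVectorBundleAction (M n →L[ℂ] ℂ) (actCot (n := n)) ∧
        (∀ (g : GL2 n) (z : Gr n) (Z : NFib z), Φ (g • z) (actN g z Z) = actEP g z (Φ z Z)) ∧
        (∀ (g : GL2 n) (z : Gr n) (t : EPFib z),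
          Ψ (g • z) (actEP g z t) = actCot g z (Ψ z t))) ∧
      (SplitsIntoOrbits actN (NOrbit n) ∧
        SplitsIntoOrbits actEP
          (fun k => totalMap (M n) (Fin n × Fin n → ℂ) Φ '' NOrbit n k) ∧
        SplitsIntoOrbits actCot
          (fun k => totalMap (M n) (M n →L[ℂ] ℂ) (fun z => (Φ z).trans (Ψ z)) '' NOrbit n k)) := by
  have hΨ (g : GL2 n) (z : Gr n) (t : EPFib z) :
      ((toTensor (g • z)).symm.trans (toCot (g • z))) (actEP g z t) =
        actCot g z (((toTensor z).symm.trans (toCot z)) t) := by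
    rw [LinearEquiv.trans_apply, LinearEquiv.trans_apply, toTensor_symm_apply,
      toTensor_symm_apply, ofTensor_actEP, toCot_actN]
  have hiso : IsVectorBundleIso (Fin n × Fin n → ℂ) (M n →L[ℂ] ℂ)
      (fun z : Gr n => (toTensor z).symm.trans (toCot z)) :=
    isVectorBundleIso_toTensor.symm.trans isVectorBundleIso_toCot
  -- The second isomorphism is defined by passing back through N, so that the composition of the two
  -- is `toCot`.
  have hcomp : (fun z : Gr n => (toTensor z).trans ((toTensor z).symm.trans (toCot z))) = toCot := by
    funext z
    ext1 Z
    simp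
  refine ⟨toTensor, fun z => (toTensor z).symm.trans (toCot z),
    ⟨isVectorBundleIso_toTensor, hiso, fun z w φ => ?_, fun z Z p hp hr X => ?_⟩,
    ⟨isVectorBundleAction_actN,
      isVectorBundleAction_actN.transport isVectorBundleIso_toTensor toTensor_actN,
      isVectorBundleAction_actN.transport isVectorBundleIso_toCot toCot_actN,
      toTensor_actN, hΨ⟩,
    splitsIntoOrbits_NOrbit, splitsIntoOrbits_NOrbit.image toTensor_actN, ?_⟩
  · exact (congrArg Subtype.val (toTensor_symm_apply z _)).trans (ofTensor_tmul w φ)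
  · rw [LinearEquiv.trans_apply, LinearEquiv.symm_apply_apply]
    exact toCot_eq_traceForm Z hp hr X
  · rw [hcomp]
    exact splitsIntoOrbits_NOrbit.image toCot_actN
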